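/- Let $d,N\ge 0$, let $T>0$, and let finitely many pairwise distinct hyperplanes $\mathcal H_1,\dots,\mathcal H_q$ of $\mathbb R^d$ be given which form at most two sets of parallel hyperplanes, hyperplanes of different sets being orthogonal. Put $\Gamma=\bigcup_j\mathcal H_j$ and **(H1)** $\mathbb R^d=\Gamma\cup\bigcup_{i=1}^m\Omega_i$, where the $\Omega_i$ are open, connected, pairwise disjoint and disjoint from $\Gamma$. Let $\Gamma_k$ be the intersections of two crossing hyperplanes together with the connected components of what these intersections leave of each hyperplane, and let $(\mathcal M_k)_k$ be the family of all $\Omega_i$ and all $\Gamma_k$, a partition of $\mathbb R^d$. Let $\mathscr A\subset\mathbb R^N$ be compact, $f:\mathbb R^d\times\mathscr A\to\mathbb R^d$, $\ell:\mathbb R^d\times\mathscr A\to\mathbb R$, $F(x)=f(x,\mathscr A)$, $L(x)=\ell(x,\mathscr A)$. Consider the hypotheses **(HF)** $F$ has nonempty compact values and is upper semicontinuous; for every $k$ and every $R>0$ the restriction of $F$ to $\mathcal M_k\cap\{|x|\le R\}$ is Lipschitz for the Hausdorff distance; there is $c_f>0$ with $|p|\le c_f(1+|x|)$ for all $x$ and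 all $p\in F(x)$. **(HL)** $L$ has nonempty compact values and is upper semicontinuous; for every $k$ and every $R>0$ the restriction of $L$ to $\mathcal M_k\cap\{|x|\le R\}$ is Lipschitz for the Hausdorff distance; there are $c_l>0$ and $\lambda_l\ge1$ with $0\le l\le c_l(1+|x|^{\lambda_l})$ for all $x$ and all $l\in L(x)$. **(HG)** The multifunction $G(x)=\{(f(x,a),-\ell(x,a)-r): a\in\mathscr A,\ 0\le r\le c_l(1+|x|^{\lambda_l})-\ell(x,a)\}$ is upper semicontinuous with compact convex values. **(H2)** There is $r_1>0$ with $B(0,r_1)\subset F(x)$ for all $x\in\Gamma$. For $x\in\overline{\mathcal M_k}$ let $F^{\rm ext}_k(x)$ be the value at $x$ of the extension by continuity of $F|_{\mathcal M_k}$ to $\overline{\mathcal M_k}$, that is, the set of all limits of $v_j\in F(x_j)$ with $x_j\in\mathcal M_k$, $x_j\to x$; let $\mathcal T_{C}(x)=\{v:\liminf_{t\to0^+}\operatorname{dist}(x+tv,C)/t=0\}$, and $$A^E(x)=\{a\in\mathscr A:\ f(x,a)\in F^{\rm ext}_k(x)\cap\mathcal T_{\overline{\mathcal M_k}}(x)\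 \text{for some }k\text{ with }x\in\overline{\mathcal M_k}\},$$ $$H^E(x,p)=\sup_{a\in A^E(x)}\{-p\cdot f(x,a)-\ell(x,a)\}\in[-\infty,\infty],\qquad \sup\emptyset=-\infty .$$ A function $u$ on $[0,T]\times\mathbb R^d$ is a supersolution of $-\partial_tu+H^E(x,Du)=0$ if it is lower semicontinuous on $(0,T]\times\mathbb R^d$ and, whenever $\phi\in C^1((0,T)\times\mathbb R^d)$ and $u-\phi$ has a local minimum at $(t_0,x_0)\in(0,T)\times\mathbb R^d$, one has $-\phi_t(t_0,x_0)+H^E(x_0,D\phi(t_0,x_0))\ge0$. **Theorem.** Assume (H1), (HF), (HL), (HG), (H2). Let $f^n:\mathbb R^d\times\mathscr A\to\mathbb R^d$ and $\ell^n:\mathbb R^d\times\mathscr A\to\mathbb R$ satisfy (HF) and (HL) with constants (growth constants and exponent, and local Lipschitz constants) that do not depend on $n$, and let $f^n\to f$ and $\ell^n\to\ell$ locally uniformly in $\mathbb R^d\times\mathscr A$. Let $H^{E,n}$ be the Hamiltonian $H^E$ built from $f^n,\ell^n$. If $u_n$ is a lower semicontinuous supersolution of $-\partial_tu_n+H^{E,n}(x,Du_n)=0$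 for each $n$ and $u_n$ converges locally uniformly in $[0,T]\times\mathbb R^d$ to a lower semicontinuous function $u$, then $u$ is a supersolution of $-\partial_tu+H^E(x,Du)=0$ on $(0,T)\times\mathbb R^d$, junction conditions on $\Gamma$ included. -/

import Mathlib

open Set Filter Topology

/-- The Euclidean space `ℝ^d`. -/
abbrev Euc (d : ℕ) : Type := EuclideanSpace ℝ (Fin d)

/-- A decomposition of `ℝ^d` into cells `Ω i` separated by finitely many pairwise distinct
hyperplanes `{x | ⟪normal j, x⟫ = offset j}`. The hyperplanes form two sets of parallel hyperplanes
(either of which may be empty), with one unit normal direction chosen for each set, and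
hyperplanes of different sets are orthogonal. -/
structure MultiDomain (d : ℕ) where
  /-- number of hyperplanes -/
  q : ℕ
  /-- number of cells -/
  m : ℕ
  /-- unit normals of the hyperplanes -/
  normal : Fin q → Euc d
  /-- offsets of the hyperplanes -/
  offset : Fin q → ℝ
  /-- which of the two sets of parallel hyperplanes the hyperplane belongs to -/
  family : Fin q → Fin 2
  norm_normal : ∀ j, ‖normal j‖ = 1
  normal_eq : ∀ i j, family i = family j → normal i = normal j
  normal_orthogonal : ∀ i j, family i ≠ family j → inner ℝ (normal i) (normal j) = 0
  hyperplanes_distinct :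
    Function.Injective fun j => {x : Euc d | inner ℝ (normal j) x = offset j}
  /-- the cells -/
  Ω : Fin m → Set (Euc d)
  cover : (⋃ j, {x : Euc d | inner ℝ (normal j) x = offset j}) ∪ (⋃ i, Ω i) = univ
  inter_eq_empty : ∀ i, (⋃ j, {x : Euc d | inner ℝ (normal j) x = offset j}) ∩ Ω i = ∅
  isOpen_Ω : ∀ i, IsOpen (Ω i)
  isConnected_Ω : ∀ i, IsConnected (Ω i)
  disjoint_Ω : ∀ i j, i ≠ j → Disjoint (Ω i) (Ω j)

namespace MultiDomain

variable {d : ℕ} (D : MultiDomain d)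

/-- The union `Γ` of the hyperplanes. -/
def Γ : Set (Euc d) := ⋃ j, {x : Euc d | inner ℝ (D.normal j) x = D.offset j}

/-- The set of points having a prescribed position with respect to every hyperplane. -/
def face (σ : Fin D.q → SignType) : Set (Euc d) :=
  {x | ∀ j, SignType.sign (inner ℝ (D.normal j) x - D.offset j) = σ j}

/-- The pieces `Γ_k` of `Γ`: the intersections of two crossing hyperplanes and the connected
components of what these intersections leave of each hyperplane. They are the nonempty faces on
which at least one of the hyperplane equations holds. -/
def interfaces : Set (Set (Euc d)) :=
  {M | M.Nonempty ∧ ∃ σ : Fin D.q → SignType, (∃ j, σ j = 0) ∧ M = D.face σ}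

/-- The subdomains `M_k`: the cells and the pieces of the interface `Γ`. -/
def strata : Set (Set (Euc d)) := range D.Ω ∪ D.interfaces

end MultiDomain

/-- The tangent cone `{v | liminf_{t → 0⁺} dist (x + t v, C) / t = 0}` of `C` at `x`. -/
def tangentConeOf {d : ℕ} (C : Set (Euc d)) (x : Euc d) : Set (Euc d) :=
  {v | liminf (fun t : ℝ => Metric.infDist (x + t • v) C / t) (𝓝[>] 0) = 0}

section Control

variable {d N : ℕ} (D : MultiDomain d) (A : Set (Euc N))
  (f : Euc d → Euc N → Euc d) (ℓ : Euc d → Euc N → ℝ)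

/-- The dynamics `F(x) = {f(x,a) : a ∈ A}`. -/
def dynamics (x : Euc d) : Set (Euc d) := f x '' A

/-- The running costs `L(x) = {ℓ(x,a) : a ∈ A}`. -/
def costs (x : Euc d) : Set ℝ := ℓ x '' A

/-- The augmented dynamics
`G(x) = {(f(x,a), -ℓ(x,a) - r) : a ∈ A, 0 ≤ r ≤ b(x,a)}`, `b(x,a) = c (1 + |x|^lam) - ℓ(x,a)`. -/
def augmentedDynamics (c lam : ℝ) (x : Euc d) : Set (Euc d × ℝ) :=
  {z | ∃ a ∈ A, ∃ r : ℝ, 0 ≤ r ∧ r ≤ c * (1 + ‖x‖ ^ lam) - ℓ x a ∧ z = (f x a, -ℓ x a - r)}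

/-- Local Lipschitz continuity, for the Hausdorff distance and up to the boundary of `M`, of the
restriction of `Φ` to `M`; `K R` is a Lipschitz constant on the part of `M` in the ball of
radius `R`. -/
def HausdorffLipschitzOn {Y : Type*} [PseudoMetricSpace Y] (Φ : Euc d → Set Y) (M : Set (Euc d))
    (K : ℝ → ℝ) : Prop :=
  ∀ R : ℝ, ∀ x ∈ M ∩ Metric.closedBall 0 R, ∀ y ∈ M ∩ Metric.closedBall 0 R,
    Metric.hausdorffDist (Φ x) (Φ y) ≤ K R * dist x y

/-- Standing hypothesis on the dynamics, with growth constant `c` and local Lipschitz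
constants `K`. -/
structure HF (c : ℝ) (K : ℝ → ℝ) : Prop where
  nonempty : ∀ x, (dynamics A f x).Nonempty
  isCompact : ∀ x, IsCompact (dynamics A f x)
  usc : UpperHemicontinuous (dynamics A f)
  lipschitz : ∀ M ∈ D.strata, HausdorffLipschitzOn (dynamics A f) M K
  const_pos : 0 < c
  growth : ∀ x, ∀ p ∈ dynamics A f x, ‖p‖ ≤ c * (1 + ‖x‖)

/-- Standing hypothesis on the running costs, with growth constants `c`, `lam` and local Lipschitz
constants `K`. -/
structure HL (c lam : ℝ) (K : ℝ → ℝ) : Prop where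
  nonempty : ∀ x, (costs A ℓ x).Nonempty
  isCompact : ∀ x, IsCompact (costs A ℓ x)
  usc : UpperHemicontinuous (costs A ℓ)
  lipschitz : ∀ M ∈ D.strata, HausdorffLipschitzOn (costs A ℓ) M K
  const_pos : 0 < c
  one_le : 1 ≤ lam
  growth : ∀ x, ∀ l ∈ costs A ℓ x, 0 ≤ l ∧ l ≤ c * (1 + ‖x‖ ^ lam)

/-- The extension by continuity to `closure M` of the restriction of `F` to `M`, given by the
closure of the graph of this restriction: its value at `x` is the set of the limits of sequences
`v_n ∈ F(x_n)` with `x_n ∈ M`, `x_n → x`. -/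
def extDynamics (M : Set (Euc d)) (x : Euc d) : Set (Euc d) :=
  {v | (x, v) ∈ closure {z : Euc d × Euc d | z.1 ∈ M ∧ z.2 ∈ dynamics A f z.1}}

/-- The essential dynamics `F^E_M(x)` of the subdomain `M`. -/
def essDynamicsOn (M : Set (Euc d)) (x : Euc d) : Set (Euc d) :=
  extDynamics A f M x ∩ tangentConeOf (closure M) x

/-- The essential controls `A^E(x)`: those `a ∈ A` with `f(x,a) ∈ F^E_M(x)` for some subdomain `M`
whose closure contains `x`. -/
def essControls (x : Euc d) : Set (Euc N) :=
  {a | a ∈ A ∧ ∃ M ∈ D.strata, x ∈ closure M ∧ f x a ∈ essDynamicsOn A f M x}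

/-- The essential Hamiltonian `H^E(x,p) = sup_{a ∈ A^E(x)} (-p · f(x,a) - ℓ(x,a))`, extended-real
valued so that the supremum over an empty set of controls is `-∞`. -/
noncomputable def essHamiltonian (x p : Euc d) : EReal :=
  ⨆ a ∈ essControls D A f x, ((-inner ℝ p (f x a) - ℓ x a : ℝ) : EReal)

/-- Viscosity supersolutions of `-∂_t u + H^E(x, Du) = 0` on `(0,T) × ℝ^d`, junction conditions on
`Γ` included. -/
def IsSupersolution (T : ℝ) (u : ℝ × Euc d → ℝ) : Prop :=
  LowerSemicontinuousOn u (Ioc 0 T ×ˢ univ) ∧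
    ∀ t₀ ∈ Ioo 0 T, ∀ x₀ : Euc d, ∀ φ : ℝ × Euc d → ℝ,
      ContDiffOn ℝ 1 φ (Ioo 0 T ×ˢ univ) →
      IsLocalMin (fun z => u z - φ z) (t₀, x₀) →
      0 ≤ ((-deriv (fun t => φ (t, x₀)) t₀ : ℝ) : EReal)
        + essHamiltonian D A f ℓ x₀ (gradient (fun x => φ (t₀, x)) x₀)

end Control

/-! ### A smooth minimum -/

/-! The proof is by contradiction at a test point `(t₀, x₀)`. If the inequality fails, then `φ_t +
Dφ · f + ℓ` has a positive lower bound over the essential controls at `x₀`, but perhaps not over all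
of `A`; the essential controls of the approximate problems near `x₀` may have limits that are not
essential. So the test function is modified near `x₀`, in the directions normal to the hyperplanes
through `x₀`, until the strict inequality holds for every control in `A` at every point that
matters.

Fix a face `τ` adjacent to `x₀`. The limit dynamics of `τ` that are tangent to `τ` are essential.
Convexity of `G(x₀)` and Hahn-Banach (`exists_multiplier`) turn positivity under the tangency
constraints into positivity on all limit dynamics of `τ`, after adding `s τ · (normal velocity)`;
the slope `s τ` can be taken with nonzero components of prescribed sign. Limit dynamics of a larger
adjacent face lie among those of `τ` (`extDynamics_localFace_subset`), so by upper semicontinuity `s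
τ` works near `x₀` on every face having `τ` in its closure (`eventually_forall_le_of_pos`,
`exists_slopes`). A convex set `S` of usable slopes is thus attached to each sign pattern.

It remains to find a `C¹` function `ψ` of the two normal coordinates, bounded above, at least `1` at
the origin, whose gradient lies in `S` wherever `ψ > 0` (`SlopeFamily.hasAdmissible`). It is built
as a smooth minimum of functions with usable slopes. Rescaling to `ε ψ(·/ε)` changes neither signs
nor gradients. For a suitable `n`, `u_n` minus the modified test function has a local minimum near
`(t₀, x₀)` at which `ψ > 0`; there the strict inequality holds for all controls of problem `n`,
contradicting the supersolution property. -/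

theorem hasDerivAt_posPart_sq (t : ℝ) : HasDerivAt (fun t : ℝ => (max t 0) ^ 2) (2 * max t 0) t := by
  have hsq : HasDerivAt (fun t : ℝ => t ^ 2) (2 * t) t := by simpa using hasDerivAt_pow 2 t
  rcases lt_trichotomy t 0 with h | h | h
  · rw [max_eq_right h.le, mul_zero]
    refine (hasDerivAt_const t (0 : ℝ)).congr_of_eventuallyEq ?_
    filter_upwards [Iio_mem_nhds h] with x hx
    simp [max_eq_right (le_of_lt (mem_Iio.1 hx))]
  · subst h
    have h1 : HasDerivWithinAt (fun t : ℝ => (max t 0) ^ 2) 0 (Iic 0) 0 :=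
      (hasDerivWithinAt_const (0 : ℝ) (Iic 0) (0 : ℝ)).congr
        (fun x hx => by simp [max_eq_right (mem_Iic.1 hx)]) (by simp)
    have h2 : HasDerivWithinAt (fun t : ℝ => (max t 0) ^ 2) 0 (Ici 0) 0 := by
      have := hsq.hasDerivWithinAt (s := Ici 0)
      rw [mul_zero] at this
      exact this.congr (fun x hx => by simp [max_eq_left (mem_Ici.1 hx)]) (by simp)
    have := h1.union h2
    rw [Iic_union_Ici, hasDerivWithinAt_univ] at this
    simpa using this
  · rw [max_eq_left h.le]
    refine hsq.congr_of_eventuallyEq ?_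
    filter_upwards [Ioi_mem_nhds h] with x hx
    simp [max_eq_left (le_of_lt (mem_Ioi.1 hx))]

theorem contDiff_posPart_sq : ContDiff ℝ 1 (fun t : ℝ => (max t 0) ^ 2) := by
  rw [contDiff_one_iff_deriv]
  refine ⟨fun t => (hasDerivAt_posPart_sq t).differentiableAt, ?_⟩
  have : deriv (fun t : ℝ => (max t 0) ^ 2) = fun t => 2 * max t 0 :=
    funext fun t => (hasDerivAt_posPart_sq t).deriv
  rw [this]
  fun_prop

/-- A `C¹` approximation of the positive part. -/
noncomputable def ramp (t : ℝ) : ℝ := (max t 0) ^ 2 / 2 - (max (t - 1) 0) ^ 2 / 2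

/-- The derivative of `ramp`. -/
noncomputable def rampDeriv (t : ℝ) : ℝ := max t 0 - max (t - 1) 0

theorem hasDerivAt_ramp (t : ℝ) : HasDerivAt ramp (rampDeriv t) t := by
  have h1 := (hasDerivAt_posPart_sq t).div_const 2
  have h2 := ((hasDerivAt_posPart_sq (t - 1)).comp t ((hasDerivAt_id t).sub_const 1)).div_const 2
  refine (h1.sub h2).congr_deriv ?_
  unfold rampDeriv; ring

theorem contDiff_ramp : ContDiff ℝ 1 ramp := by
  have h2 : ContDiff ℝ 1 (fun t : ℝ => (max (t - 1) 0) ^ 2) :=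
    contDiff_posPart_sq.comp (contDiff_id.sub contDiff_const)
  exact (contDiff_posPart_sq.div_const 2).sub (h2.div_const 2)

theorem rampDeriv_nonneg (t : ℝ) : 0 ≤ rampDeriv t :=
  sub_nonneg.2 (max_le_max (by linarith) le_rfl)

theorem rampDeriv_le_one (t : ℝ) : rampDeriv t ≤ 1 := by
  unfold rampDeriv
  rcases max_cases t 0 with h | h <;> rcases max_cases (t - 1) 0 with h' | h' <;> linarith

theorem rampDeriv_of_nonpos {t : ℝ} (h : t ≤ 0) : rampDeriv t = 0 := by
  simp [rampDeriv, max_eq_right h, max_eq_right (by linarith : t - 1 ≤ 0)]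

theorem rampDeriv_of_one_le {t : ℝ} (h : 1 ≤ t) : rampDeriv t = 1 := by
  simp [rampDeriv, max_eq_left (by linarith : 0 ≤ t), max_eq_left (by linarith : 0 ≤ t - 1)]

theorem ramp_of_nonpos {t : ℝ} (h : t ≤ 0) : ramp t = 0 := by
  simp [ramp, max_eq_right h, max_eq_right (by linarith : t - 1 ≤ 0)]

theorem ramp_nonneg (t : ℝ) : 0 ≤ ramp t := by
  have : max (t - 1) 0 ≤ max t 0 := max_le_max (by linarith) le_rfl
  have h0 : 0 ≤ max (t - 1) 0 := le_max_right _ _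
  unfold ramp; nlinarith

theorem ramp_le {t : ℝ} (h : 0 ≤ t) : ramp t ≤ t := by
  unfold ramp
  rw [max_eq_left h]
  rcases max_cases (t - 1) 0 with h' | h' <;> rw [h'.1] <;> nlinarith

theorem sub_half_le_ramp (t : ℝ) : t - 1 / 2 ≤ ramp t := by
  unfold ramp
  rcases max_cases t 0 with h | h <;> rcases max_cases (t - 1) 0 with h' | h' <;>
    rw [h.1, h'.1] <;> nlinarith [sq_nonneg (t - 1)]

/-- A `C¹` approximation of the minimum. -/
noncomputable def smin (x y : ℝ) : ℝ := x - ramp (x - y)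

theorem smin_le_left (x y : ℝ) : smin x y ≤ x := by
  have := ramp_nonneg (x - y); unfold smin; linarith

theorem smin_le_right (x y : ℝ) : smin x y ≤ y + 1 / 2 := by
  have := sub_half_le_ramp (x - y); unfold smin; linarith

theorem le_smin {x y z : ℝ} (h1 : z ≤ x) (h2 : z ≤ y) : z ≤ smin x y := by
  unfold smin
  rcases le_total x y with h | h
  · rw [ramp_of_nonpos (by linarith)]; linarith
  · have := ramp_le (sub_nonneg.2 h); linarith

/-- The linear form on the plane with gradient `g`. -/
noncomputable def planeForm (g : ℝ × ℝ) : ℝ × ℝ →L[ℝ] ℝ :=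
  g.1 • ContinuousLinearMap.fst ℝ ℝ ℝ + g.2 • ContinuousLinearMap.snd ℝ ℝ ℝ

@[simp] theorem planeForm_apply (g v : ℝ × ℝ) : planeForm g v = g.1 * v.1 + g.2 * v.2 := by
  simp [planeForm]

theorem contDiff_affine (c : ℝ) (g : ℝ × ℝ) : ContDiff ℝ 1 (fun y => c + planeForm g y) :=
  contDiff_const.add (planeForm g).contDiff

theorem hasFDerivAt_affine (c : ℝ) (g y : ℝ × ℝ) :
    HasFDerivAt (fun y => c + planeForm g y) (planeForm g) y :=
  (planeForm g).hasFDerivAt.const_add c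

theorem ContDiff.smin {f h : ℝ × ℝ → ℝ} (hf : ContDiff ℝ 1 f) (hh : ContDiff ℝ 1 h) :
    ContDiff ℝ 1 (fun y => smin (f y) (h y)) :=
  hf.sub (contDiff_ramp.comp (hf.sub hh))

theorem hasFDerivAt_smin {f h : ℝ × ℝ → ℝ} {g k y : ℝ × ℝ}
    (hf : HasFDerivAt f (planeForm g) y) (hh : HasFDerivAt h (planeForm k) y) :
    HasFDerivAt (fun y => smin (f y) (h y))
      (planeForm ((1 - rampDeriv (f y - h y)) • g + rampDeriv (f y - h y) • k)) y := by
  have := hf.sub ((hasDerivAt_ramp (f y - h y)).comp_hasFDerivAt y (hf.sub hh))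
  refine this.congr_fderiv ?_
  ext <;> simp <;> ring

/-- `ψ` is differentiable at `y` and its gradient belongs to the set attached by `S` to the signs of
the coordinates of `y`. -/
def AdmissibleAt (S : SignType → SignType → Set (ℝ × ℝ)) (ψ : ℝ × ℝ → ℝ) (y : ℝ × ℝ) : Prop :=
  ∃ g ∈ S (SignType.sign y.1) (SignType.sign y.2), HasFDerivAt ψ (planeForm g) y

/-- `smin` equals its first argument, to first order as well, wherever that argument is not larger;
elsewhere its gradient is a convex combination of the two. Hence the second function has to be
admissible only where it is strictly smaller. -/
theorem admissibleAt_smin {S : SignType → SignType → Set (ℝ × ℝ)} (hS : ∀ σ τ, Convex ℝ (S σ τ))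
    {f h : ℝ × ℝ → ℝ} (hh : Differentiable ℝ h) {y : ℝ × ℝ}
    (h1 : AdmissibleAt S f y) (h2 : h y < f y → AdmissibleAt S h y) :
    AdmissibleAt S (fun y => smin (f y) (h y)) y := by
  obtain ⟨g, hg, hfg⟩ := h1
  by_cases hlt : h y < f y
  · obtain ⟨k, hk, hhk⟩ := h2 hlt
    refine ⟨_, (hS _ _) hg hk (sub_nonneg.2 (rampDeriv_le_one _)) (rampDeriv_nonneg _) (by ring),
      hasFDerivAt_smin hfg hhk⟩
  · refine ⟨g, hg, ?_⟩
    have hd : HasFDerivAt h (planeForm (fderiv ℝ h y (1, 0), fderiv ℝ h y (0, 1))) y := by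
      refine (hh y).hasFDerivAt.congr_fderiv ?_
      ext <;> simp
    have := hasFDerivAt_smin hfg hd
    rw [rampDeriv_of_nonpos (by linarith)] at this
    simpa using this

/-- A lower bound for affine functions on a box. -/
theorem le_affine_of_mem_box (M Y : ℝ) (g y : ℝ × ℝ) (h1 : |y.1| ≤ Y) (h2 : |y.2| ≤ Y) :
    M ≤ M + (|g.1| + |g.2|) * Y + planeForm g y := by
  rw [planeForm_apply]
  have e1 : |g.1 * y.1| ≤ |g.1| * Y := by
    rw [abs_mul]; exact mul_le_mul_of_nonneg_left h1 (abs_nonneg _)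
  have e2 : |g.2 * y.2| ≤ |g.2| * Y := by
    rw [abs_mul]; exact mul_le_mul_of_nonneg_left h2 (abs_nonneg _)
  have := neg_abs_le (g.1 * y.1)
  have := neg_abs_le (g.2 * y.2)
  nlinarith

/-! ### A perturbation of the test function in the plane -/

theorem admissibleAt_affine {S : SignType → SignType → Set (ℝ × ℝ)} {c : ℝ} {g y : ℝ × ℝ}
    (h : g ∈ S (SignType.sign y.1) (SignType.sign y.2)) :
    AdmissibleAt S (fun y => c + planeForm g y) y :=
  ⟨g, h, hasFDerivAt_affine c g y⟩

/-- The increasing affine function of slope `p` is cut on the right by slope `p10` and above by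
`p01`. What survives is unbounded only inside the open positive quadrant, where a last cut with the
decreasing slope `p11` is allowed. -/
theorem exists_admissible_of_pos_pos {S : SignType → SignType → Set (ℝ × ℝ)}
    (hS : ∀ σ τ, Convex ℝ (S σ τ)) {p p10 p01 p11 : ℝ × ℝ} (h00 : ∀ σ τ, p ∈ S σ τ)
    (h10 : ∀ τ, p10 ∈ S 1 τ) (h01 : ∀ σ, p01 ∈ S σ 1) (h11 : p11 ∈ S 1 1)
    (ha : 0 < p.1) (hb : 0 < p.2) (ha10 : p10.1 < 0) (hb10 : 0 < p10.2)
    (ha01 : 0 < p01.1) (hb01 : p01.2 < 0) (ha11 : p11.1 < 0) (hb11 : p11.2 < 0) :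
    ∃ (ψ : ℝ × ℝ → ℝ) (C : ℝ), ContDiff ℝ 1 ψ ∧ 1 ≤ ψ 0 ∧ (∀ y, ψ y ≤ C) ∧
      ∀ y, 0 < ψ y → AdmissibleAt S ψ y := by
  set D := p10.2 - p01.2 with hD
  have hDpos : 0 < D := by linarith
  -- Upper bound of `g0` on the region `y.1 ≤ 0`, `y.2 ≤ 1 / D`; `Y` bounds the part of it where `g0
  -- > 0`.
  set M := 1 + p.2 / D with hM
  have hM1 : 1 ≤ M := by have := div_pos hb hDpos; linarith
  set Y := M / p.1 + 1 / p.2 + 1 / D with hY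
  have hYa : 0 < M / p.1 := by positivity
  have hYb : 0 < 1 / p.2 := by positivity
  have hYD : 0 < 1 / D := by positivity
  set c := M + (|p10.1| + |p10.2| + |p01.1| + |p01.2|) * Y with hc
  have hc1 : M + (|p10.1| + |p10.2|) * Y ≤ c := by
    have : 0 ≤ (|p01.1| + |p01.2|) * Y := by positivity
    rw [hc]; linarith
  have hc2 : M + (|p01.1| + |p01.2|) * Y ≤ c := by
    have : 0 ≤ (|p10.1| + |p10.2|) * Y := by positivity
    rw [hc]; linarith
  have hcM : M ≤ c := by
    have : 0 ≤ (|p10.1| + |p10.2|) * Y := by positivity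
    linarith
  set g0 : ℝ × ℝ → ℝ := fun y => 1 + planeForm p y with hg0
  set g1 : ℝ × ℝ → ℝ := fun y => c + planeForm p10 y with hg1
  set g2 : ℝ × ℝ → ℝ := fun y => c + planeForm p01 y with hg2
  set h : ℝ × ℝ → ℝ := fun y => smin (g1 y) (g2 y) with hh
  have hhC : ContDiff ℝ 1 h := (contDiff_affine c p10).smin (contDiff_affine c p01)
  set ψ₁ : ℝ × ℝ → ℝ := fun y => smin (g0 y) (h y) with hψ₁
  have hψ₁C : ContDiff ℝ 1 ψ₁ := (contDiff_affine 1 p).smin hhC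
  have hψ₁0 : ∀ y, ψ₁ y ≤ g0 y := fun y => smin_le_left _ _
  have hψ₁1 : ∀ y, ψ₁ y ≤ g1 y + 1 / 2 := fun y =>
    (smin_le_right _ _).trans (by have := smin_le_left (g1 y) (g2 y); simp only [hh]; linarith)
  have hψ₁2 : ∀ y, ψ₁ y ≤ g2 y + 1 := fun y =>
    (smin_le_right _ _).trans (by have := smin_le_right (g1 y) (g2 y); simp only [hh]; linarith)
  have hgrad : ∀ y, HasFDerivAt h (planeForm ((1 - rampDeriv (g1 y - g2 y)) • p10 +
      rampDeriv (g1 y - g2 y) • p01)) y := fun y =>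
    hasFDerivAt_smin (hasFDerivAt_affine c p10 y) (hasFDerivAt_affine c p01 y)
  have hadm₁ : ∀ y, 0 < ψ₁ y → AdmissibleAt S ψ₁ y := by
    intro y hy
    refine admissibleAt_smin hS (hhC.differentiable one_ne_zero) (admissibleAt_affine (h00 _ _)) ?_
    intro hlt
    have hpos : 0 < g0 y := hy.trans_le (hψ₁0 y)
    simp only [hg0, planeForm_apply] at hpos
    rcases le_or_gt y.1 0 with h1 | h1
    -- For `y.2 ≤ 1 / D` the point lies in the box where `h ≥ M ≥ g0`, so `h` would not be active.
    -- Above that level `g1 - g2 ≥ 1`, and the blend is purely `p01`, as required where `p10` is not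
    -- allowed.
    · have h2 : 1 / D < y.2 := by
        by_contra! h2
        have e1 : p.2 * y.2 ≤ p.2 / D := by
          rw [div_eq_mul_one_div]; exact mul_le_mul_of_nonneg_left h2 hb.le
        have e2 : p.1 * y.1 ≤ 0 := mul_nonpos_of_nonneg_of_nonpos ha.le h1
        have b1 : -y.1 < M / p.1 := by rw [lt_div_iff₀ ha]; linarith
        have b2 : -y.2 < 1 / p.2 := by rw [lt_div_iff₀ hb]; linarith
        have hy1 : |y.1| ≤ Y := abs_le.2 ⟨by linarith, by linarith⟩
        have hy2 : |y.2| ≤ Y := abs_le.2 ⟨by linarith, by linarith⟩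
        have k1 := le_affine_of_mem_box M Y p10 y hy1 hy2
        have k2 := le_affine_of_mem_box M Y p01 y hy1 hy2
        have : M ≤ h y := le_smin (by simp only [hg1]; linarith) (by simp only [hg2]; linarith)
        have : g0 y ≤ M := by simp only [hg0, planeForm_apply]; linarith
        linarith
      have hs : SignType.sign y.2 = 1 := sign_pos (hYD.trans h2)
      have hone : 1 ≤ g1 y - g2 y := by
        simp only [hg1, hg2, planeForm_apply]
        have e1 : 0 ≤ (p10.1 - p01.1) * y.1 := mul_nonneg_of_nonpos_of_nonpos (by linarith) h1
        have e2 : 1 < D * y.2 := by rwa [div_lt_iff₀' hDpos] at h2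
        rw [hD] at e2; linarith
      refine ⟨p01, hs ▸ h01 _, ?_⟩
      have := hgrad y
      rw [rampDeriv_of_one_le hone] at this
      simpa using this
    · have hs1 : SignType.sign y.1 = 1 := sign_pos h1
      rcases le_or_gt y.2 0 with h2 | h2
      · refine ⟨p10, hs1 ▸ h10 _, ?_⟩
        have hz : g1 y - g2 y ≤ 0 := by
          simp only [hg1, hg2, planeForm_apply]
          have e1 : (p10.1 - p01.1) * y.1 ≤ 0 :=
            mul_nonpos_of_nonpos_of_nonneg (by linarith) h1.le
          have e2 : D * y.2 ≤ 0 := mul_nonpos_of_nonneg_of_nonpos hDpos.le h2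
          rw [hD] at e2; linarith
        have := hgrad y
        rw [rampDeriv_of_nonpos hz] at this
        simpa using this
      · have hs2 : SignType.sign y.2 = 1 := sign_pos h2
        refine ⟨_, ?_, hgrad y⟩
        rw [hs1, hs2]
        exact hS 1 1 (h10 1) (h01 1) (sub_nonneg.2 (rampDeriv_le_one _)) (rampDeriv_nonneg _)
          (by ring)
  -- `M'` and `Y'` bound the value and the location of the points outside the open positive quadrant
  -- where `ψ₁ > 0`; the final cut is placed above `M'` on that box, so it acts only inside the
  -- quadrant.
  set M' := c + 1 with hM'
  set Y' := 1 / p.1 + 1 / p.2 + M' / p01.1 + M' / (-p01.2) + M' / (-p10.1) + M' / p10.2 with hY'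
  have hM'pos : 0 < M' := by linarith
  have q1 : 0 < 1 / p.1 := by positivity
  have q3 : 0 < M' / p01.1 := by positivity
  have q4 : 0 < M' / (-p01.2) := div_pos hM'pos (by linarith)
  have q5 : 0 < M' / (-p10.1) := div_pos hM'pos (by linarith)
  have q6 : 0 < M' / p10.2 := by positivity
  have hbox : ∀ y, 0 < ψ₁ y → (y.1 ≤ 0 ∨ y.2 ≤ 0) → ψ₁ y ≤ M' ∧ |y.1| ≤ Y' ∧ |y.2| ≤ Y' := by
    intro y hy hor
    have e0 := hψ₁0 y
    have e1 := hψ₁1 y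
    have e2 := hψ₁2 y
    simp only [hg0, hg1, hg2, planeForm_apply] at e0 e1 e2
    rcases le_or_gt y.1 0 with h1 | h1 <;> rcases le_or_gt y.2 0 with h2 | h2
    · have k1 : p.1 * y.1 ≤ 0 := mul_nonpos_of_nonneg_of_nonpos ha.le h1
      have k2 : p.2 * y.2 ≤ 0 := mul_nonpos_of_nonneg_of_nonpos hb.le h2
      have b1 : -y.1 < 1 / p.1 := by rw [lt_div_iff₀ ha]; linarith
      have b2 : -y.2 < 1 / p.2 := by rw [lt_div_iff₀ hb]; linarith
      exact ⟨by linarith, abs_le.2 ⟨by linarith, by linarith⟩, abs_le.2 ⟨by linarith, by linarith⟩⟩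
    · have k1 : p01.1 * y.1 ≤ 0 := mul_nonpos_of_nonneg_of_nonpos ha01.le h1
      have k2 : p01.2 * y.2 ≤ 0 := mul_nonpos_of_nonpos_of_nonneg hb01.le h2.le
      have b1 : -y.1 < M' / p01.1 := by rw [lt_div_iff₀ ha01]; linarith
      have b2 : y.2 < M' / (-p01.2) := by rw [lt_div_iff₀ (by linarith)]; linarith
      exact ⟨by linarith, abs_le.2 ⟨by linarith, by linarith⟩, abs_le.2 ⟨by linarith, by linarith⟩⟩
    · have k1 : p10.1 * y.1 ≤ 0 := mul_nonpos_of_nonpos_of_nonneg ha10.le h1.le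
      have k2 : p10.2 * y.2 ≤ 0 := mul_nonpos_of_nonneg_of_nonpos hb10.le h2
      have b1 : y.1 < M' / (-p10.1) := by rw [lt_div_iff₀ (by linarith)]; linarith
      have b2 : -y.2 < M' / p10.2 := by rw [lt_div_iff₀ hb10]; linarith
      exact ⟨by linarith, abs_le.2 ⟨by linarith, by linarith⟩, abs_le.2 ⟨by linarith, by linarith⟩⟩
    · rcases hor with h | h <;> linarith
  set c' := M' + (|p11.1| + |p11.2|) * Y' with hc'
  have hc'M : M' ≤ c' := by
    have : 0 ≤ (|p11.1| + |p11.2|) * Y' := by positivity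
    linarith
  refine ⟨fun y => smin (ψ₁ y) (c' + planeForm p11 y), c' + 1 / 2,
    hψ₁C.smin (contDiff_affine c' p11), ?_, ?_, ?_⟩
  · refine le_smin (le_smin ?_ (le_smin ?_ ?_)) ?_ <;> simp [hg0, hg1, hg2] <;> linarith
  · intro y
    by_cases hor : y.1 ≤ 0 ∨ y.2 ≤ 0
    · refine (smin_le_left _ _).trans ?_
      rcases le_or_gt (ψ₁ y) 0 with hle | hpos
      · linarith
      · linarith [(hbox y hpos hor).1]
    · push Not at hor
      refine (smin_le_right _ _).trans ?_
      have k1 : p11.1 * y.1 ≤ 0 := mul_nonpos_of_nonpos_of_nonneg ha11.le hor.1.le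
      have k2 : p11.2 * y.2 ≤ 0 := mul_nonpos_of_nonpos_of_nonneg hb11.le hor.2.le
      rw [planeForm_apply]; linarith
  · intro y hy
    have hpos : 0 < ψ₁ y := hy.trans_le (smin_le_left _ _)
    refine admissibleAt_smin hS ((contDiff_affine c' p11).differentiable one_ne_zero)
      (hadm₁ y hpos) fun hlt => ?_
    by_cases hor : y.1 ≤ 0 ∨ y.2 ≤ 0
    · obtain ⟨k1, k2, k3⟩ := hbox y hpos hor
      have := le_affine_of_mem_box M' Y' p11 y k2 k3
      linarith
    · push Not at hor
      exact admissibleAt_affine (by rw [sign_pos hor.1, sign_pos hor.2]; exact h11)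

/-- The segment from `p` to `g` crosses the height `-k`. Slopes brought to one height can be blended
in the first coordinate alone. -/
theorem exists_level_point {p g : ℝ × ℝ} {k : ℝ} (hp : -k ≤ p.2) (hg : g.2 ≤ -k)
    (hlt : g.2 < p.2) :
    ∃ r : ℝ, (∀ T : Set (ℝ × ℝ), Convex ℝ T → p ∈ T → g ∈ T → (r, -k) ∈ T) ∧
      (0 < p.1 → 0 < g.1 → 0 < r) := by
  have hd : 0 < p.2 - g.2 := sub_pos.2 hlt
  set θ := (p.2 + k) / (p.2 - g.2) with hθ
  have h0 : 0 ≤ θ := div_nonneg (by linarith) hd.le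
  have h1 : 0 ≤ 1 - θ := by
    rw [sub_nonneg, hθ, div_le_one hd]; linarith
  have hmul : θ * (p.2 - g.2) = p.2 + k := div_mul_cancel₀ _ hd.ne'
  refine ⟨(1 - θ) * p.1 + θ * g.1, fun T hT hpT hgT => ?_, fun hp1 hg1 => ?_⟩
  · convert hT hpT hgT h1 h0 (by ring) using 1
    ext
    · simp
    · simp; linarith
  · rcases h0.eq_or_lt with h | h
    · rw [← h]; simpa using hp1
    · have := mul_pos h hg1
      have := mul_nonneg h1 hp1.le
      linarith

/-- The cut has constant slope `-k` in `y.2`, while its slope in `y.1` passes from `γ` through `β`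
to `α`. Since `γ > 0` and `k > 0`, it decreases both leftwards and upwards in the upper left
quadrant; in the lower left quadrant `p` already decreases away from the origin. -/
theorem exists_admissible_bounded_on_left {S : SignType → SignType → Set (ℝ × ℝ)}
    (hS : ∀ σ τ, Convex ℝ (S σ τ)) {p p10 p01 pm : ℝ × ℝ} (h00 : ∀ σ τ, p ∈ S σ τ)
    (h10 : ∀ τ, p10 ∈ S 1 τ) (h01 : ∀ σ, p01 ∈ S σ 1) (hm : pm ∈ S (-1) 1)
    (ha : 0 < p.1) (hb : 0 < p.2) (hb10 : p10.2 < 0) (hb01 : p01.2 < 0)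
    (ham : 0 < pm.1) (hbm : pm.2 < 0) :
    ∃ (ψ₁ : ℝ × ℝ → ℝ) (M₁ Y₁ : ℝ), ContDiff ℝ 1 ψ₁ ∧ 1 ≤ ψ₁ 0 ∧ 1 ≤ M₁ ∧ 0 < Y₁ ∧
      (∀ y, 0 < ψ₁ y → y.1 ≤ 0 → ψ₁ y ≤ M₁ ∧ |y.1| ≤ Y₁ ∧ |y.2| ≤ Y₁) ∧
      ∀ y, 0 < ψ₁ y → AdmissibleAt S ψ₁ y := by
  obtain ⟨k, hk, hk10, hk01, hkm⟩ : ∃ k : ℝ, 0 < k ∧ p10.2 ≤ -k ∧ p01.2 ≤ -k ∧ pm.2 ≤ -k := by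
    refine ⟨min (-p10.2) (min (-p01.2) (-pm.2)), ?_, ?_, ?_, ?_⟩
    · simp [hb10, hb01, hbm]
    · rw [le_neg]; exact min_le_left _ _
    · rw [le_neg]; exact (min_le_right _ _).trans (min_le_left _ _)
    · rw [le_neg]; exact (min_le_right _ _).trans (min_le_right _ _)
  obtain ⟨α, hα, -⟩ := exists_level_point (p := p) (g := p10) (k := k) (by linarith) hk10
    (by linarith)
  obtain ⟨β, hβ, -⟩ := exists_level_point (p := p) (g := p01) (k := k) (by linarith) hk01
    (by linarith)
  obtain ⟨γ, hγ, hγ0⟩ := exists_level_point (p := p) (g := pm) (k := k) (by linarith) hkm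
    (by linarith)
  replace hα : ∀ τ, (α, -k) ∈ S 1 τ := fun τ => hα _ (hS _ _) (h00 _ _) (h10 _)
  replace hβ : ∀ σ, (β, -k) ∈ S σ 1 := fun σ => hβ _ (hS _ _) (h00 _ _) (h01 _)
  replace hγ : (γ, -k) ∈ S (-1) 1 := hγ _ (hS _ _) (h00 _ _) hm
  replace hγ0 : 0 < γ := hγ0 ha ham
  -- `θ'` equals `γ` for `t ≤ -1`, `β` at `0` and `α` for `t ≥ 1`.
  set θ : ℝ → ℝ := fun t => β * t + (α - β) * ramp t - (γ - β) * ramp (-t) with hθ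
  have hθC : ContDiff ℝ 1 θ :=
    ((contDiff_const.mul contDiff_id).add (contDiff_const.mul contDiff_ramp)).sub
      (contDiff_const.mul (contDiff_ramp.comp contDiff_neg))
  have hθd : ∀ t, HasDerivAt θ (β + (α - β) * rampDeriv t + (γ - β) * rampDeriv (-t)) t := by
    intro t
    have h1 := (hasDerivAt_id t).const_mul β
    have h2 := (hasDerivAt_ramp t).const_mul (α - β)
    have h3 := ((hasDerivAt_ramp (-t)).comp t (hasDerivAt_neg t)).const_mul (γ - β)
    refine ((h1.add h2).sub h3).congr_deriv ?_
    ring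
  have hrabs : ∀ t, |ramp t| ≤ |t| := by
    intro t
    rcases le_total t 0 with h | h
    · rw [ramp_of_nonpos h]; simp
    · rw [abs_of_nonneg (ramp_nonneg t), abs_of_nonneg h]; exact ramp_le h
  set Y := 1 + 1 / p.1 with hY
  have hYa : 0 < 1 / p.1 := by positivity
  -- With this `c` the cut dominates `g0` when `y.2 ≤ 0`, `y.1 ≤ 1` and `g0 > 0`. Below the first
  -- axis it thus acts only for `y.1 ≥ 1`, where its slope is exactly `(α, -k)`.
  set c := 1 + p.1 + (|β| + |α - β| + |γ - β|) * Y with hc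
  have hc0 : 0 ≤ (|β| + |α - β| + |γ - β|) * Y := by positivity
  have hθlow : ∀ t, |t| ≤ Y → 1 + p.1 ≤ c + θ t := by
    intro t ht
    have e1 : |β * t| ≤ |β| * Y := by
      rw [abs_mul]; exact mul_le_mul_of_nonneg_left ht (abs_nonneg _)
    have e2 : |(α - β) * ramp t| ≤ |α - β| * Y := by
      rw [abs_mul]; exact mul_le_mul_of_nonneg_left ((hrabs t).trans ht) (abs_nonneg _)
    have e3 : |(γ - β) * ramp (-t)| ≤ |γ - β| * Y := by
      rw [abs_mul]
      exact mul_le_mul_of_nonneg_left ((hrabs (-t)).trans (by rwa [abs_neg])) (abs_nonneg _)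
    have := neg_abs_le (β * t)
    have := neg_abs_le ((α - β) * ramp t)
    have := le_abs_self ((γ - β) * ramp (-t))
    simp only [hθ, hc]; linarith
  set g0 : ℝ × ℝ → ℝ := fun y => 1 + planeForm p y with hg0
  set h : ℝ × ℝ → ℝ := fun y => c + θ y.1 - k * y.2 with hh
  have hhC : ContDiff ℝ 1 h :=
    (contDiff_const.add (hθC.comp contDiff_fst)).sub (contDiff_const.mul contDiff_snd)
  have hgrad : ∀ y : ℝ × ℝ, HasFDerivAt h
      (planeForm (β + (α - β) * rampDeriv y.1 + (γ - β) * rampDeriv (-y.1), -k)) y := by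
    intro y
    have hf : HasFDerivAt (fun y : ℝ × ℝ => y.1) (ContinuousLinearMap.fst ℝ ℝ ℝ) y :=
      hasFDerivAt_fst
    have h1 := (hθd y.1).comp_hasFDerivAt (f := fun y : ℝ × ℝ => y.1) y hf
    have h2 : HasFDerivAt (fun y : ℝ × ℝ => k * y.2) _ y :=
      (hasFDerivAt_snd (𝕜 := ℝ) (E := ℝ) (F := ℝ) (p := y)).const_mul k
    refine ((h1.const_add c).sub h2).congr_fderiv ?_
    ext <;> simp
  set ψ₁ : ℝ × ℝ → ℝ := fun y => smin (g0 y) (h y) with hψ₁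
  have hψ₁C : ContDiff ℝ 1 ψ₁ := (contDiff_affine 1 p).smin hhC
  have hψ₁0 : ∀ y, ψ₁ y ≤ g0 y := fun y => smin_le_left _ _
  have hψ₁1 : ∀ y, ψ₁ y ≤ h y + 1 / 2 := fun y => smin_le_right _ _
  have hadm₁ : ∀ y, 0 < ψ₁ y → AdmissibleAt S ψ₁ y := by
    intro y hy
    refine admissibleAt_smin hS (hhC.differentiable one_ne_zero) (admissibleAt_affine (h00 _ _)) ?_
    intro hlt
    have hpos : 0 < g0 y := hy.trans_le (hψ₁0 y)
    simp only [hg0, planeForm_apply] at hpos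
    refine ⟨_, ?_, hgrad y⟩
    rcases le_or_gt y.2 0 with h2 | h2
    · have h1 : 1 ≤ y.1 := by
        by_contra! h1
        have e2 : p.2 * y.2 ≤ 0 := mul_nonpos_of_nonneg_of_nonpos hb.le h2
        have b1 : -y.1 < 1 / p.1 := by rw [lt_div_iff₀ ha]; linarith
        have := hθlow y.1 (abs_le.2 ⟨by linarith, by linarith⟩)
        have e3 : k * y.2 ≤ 0 := mul_nonpos_of_nonneg_of_nonpos hk.le h2
        have e4 : p.1 * y.1 ≤ p.1 * 1 := mul_le_mul_of_nonneg_left h1.le ha.le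
        simp only [hh, hg0, planeForm_apply] at hlt
        linarith
      rw [sign_pos (by linarith : 0 < y.1), rampDeriv_of_one_le h1,
        rampDeriv_of_nonpos (by linarith : -y.1 ≤ 0)]
      simpa using hα _
    · rw [sign_pos h2]
      rcases lt_trichotomy y.1 0 with h1 | h1 | h1
      · rw [sign_neg h1, rampDeriv_of_nonpos h1.le]
        convert hS (-1) 1 (hβ (-1)) hγ (sub_nonneg.2 (rampDeriv_le_one (-y.1)))
          (rampDeriv_nonneg _) (by ring) using 1
        ext <;> simp <;> ring
      · rw [h1]
        simpa [rampDeriv_of_nonpos] using hβ _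
      · rw [sign_pos h1, rampDeriv_of_nonpos (by linarith : -y.1 ≤ 0)]
        convert hS 1 1 (hβ 1) (hα 1) (sub_nonneg.2 (rampDeriv_le_one y.1))
          (rampDeriv_nonneg _) (by ring) using 1
        ext <;> simp <;> ring
  set E := c + |γ - β| / 2 + 1 / 2 with hE
  have hEpos : 0 < E := by positivity
  set M₁ := 1 + E with hM₁
  set Y₁ := 1 / p.1 + 1 / p.2 + E / γ + E / k with hY₁
  have hYb : 0 < 1 / p.2 := by positivity
  have hYγ : 0 < E / γ := by positivity
  have hYk : 0 < E / k := by positivity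
  have hbox₁ : ∀ y, 0 < ψ₁ y → y.1 ≤ 0 → ψ₁ y ≤ M₁ ∧ |y.1| ≤ Y₁ ∧ |y.2| ≤ Y₁ := by
    intro y hy h1
    have e0 := hψ₁0 y
    have e1 := hψ₁1 y
    simp only [hg0, hh, planeForm_apply] at e0 e1
    rcases le_or_gt y.2 0 with h2 | h2
    · have k1 : p.1 * y.1 ≤ 0 := mul_nonpos_of_nonneg_of_nonpos ha.le h1
      have k2 : p.2 * y.2 ≤ 0 := mul_nonpos_of_nonneg_of_nonpos hb.le h2
      have b1 : -y.1 < 1 / p.1 := by rw [lt_div_iff₀ ha]; linarith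
      have b2 : -y.2 < 1 / p.2 := by rw [lt_div_iff₀ hb]; linarith
      exact ⟨by linarith, abs_le.2 ⟨by linarith, by linarith⟩, abs_le.2 ⟨by linarith, by linarith⟩⟩
    · have hθu : θ y.1 ≤ γ * y.1 + |γ - β| / 2 := by
        have r1 := ramp_le (t := -y.1) (by linarith)
        have r2 := sub_half_le_ramp (-y.1)
        have : |(γ - β) * (ramp (-y.1) + y.1)| ≤ |γ - β| * (1 / 2) := by
          rw [abs_mul]
          exact mul_le_mul_of_nonneg_left (abs_le.2 ⟨by linarith, by linarith⟩) (abs_nonneg _)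
        have := neg_abs_le ((γ - β) * (ramp (-y.1) + y.1))
        simp only [hθ, ramp_of_nonpos h1]; linarith
      have k1 : γ * y.1 ≤ 0 := mul_nonpos_of_nonneg_of_nonpos hγ0.le h1
      have k2 : 0 < k * y.2 := mul_pos hk h2
      have b1 : -y.1 < E / γ := by rw [lt_div_iff₀ hγ0]; linarith
      have b2 : y.2 < E / k := by rw [lt_div_iff₀ hk]; linarith
      exact ⟨by linarith, abs_le.2 ⟨by linarith, by linarith⟩, abs_le.2 ⟨by linarith, by linarith⟩⟩
  refine ⟨ψ₁, M₁, Y₁, hψ₁C, le_smin ?_ ?_, by linarith, by positivity, hbox₁, hadm₁⟩ <;>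
    simp [hg0, hh, hθ, ramp_of_nonpos] <;> linarith

/-- Once the left half-plane is controlled, `p10` can be used on the whole right half-plane and
bounds the upper right quadrant. Only the lower right quadrant remains, and there `pq` decreases
away from the origin. -/
theorem exists_admissible_of_neg {S : SignType → SignType → Set (ℝ × ℝ)}
    (hS : ∀ σ τ, Convex ℝ (S σ τ)) {p p10 p01 pm pq : ℝ × ℝ} (h00 : ∀ σ τ, p ∈ S σ τ)
    (h10 : ∀ τ, p10 ∈ S 1 τ) (h01 : ∀ σ, p01 ∈ S σ 1) (hm : pm ∈ S (-1) 1) (hq : pq ∈ S 1 (-1))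
    (ha : 0 < p.1) (hb : 0 < p.2) (ha10 : p10.1 < 0) (hb10 : p10.2 < 0) (hb01 : p01.2 < 0)
    (ham : 0 < pm.1) (hbm : pm.2 < 0) (haq : pq.1 < 0) (hbq : 0 < pq.2) :
    ∃ (ψ : ℝ × ℝ → ℝ) (C : ℝ), ContDiff ℝ 1 ψ ∧ 1 ≤ ψ 0 ∧ (∀ y, ψ y ≤ C) ∧
      ∀ y, 0 < ψ y → AdmissibleAt S ψ y := by
  obtain ⟨ψ₁, M₁, Y₁, hψ₁C, hψ₁z, hM₁, hY₁pos, hbox₁, hadm₁⟩ :=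
    exists_admissible_bounded_on_left hS h00 h10 h01 hm ha hb hb10 hb01 ham hbm
  set c₁ := M₁ + (|p10.1| + |p10.2|) * Y₁ with hc₁
  have hc₁M : M₁ ≤ c₁ := by
    have : 0 ≤ (|p10.1| + |p10.2|) * Y₁ := by positivity
    linarith
  set ψ₂ : ℝ × ℝ → ℝ := fun y => smin (ψ₁ y) (c₁ + planeForm p10 y) with hψ₂
  have hψ₂C : ContDiff ℝ 1 ψ₂ := hψ₁C.smin (contDiff_affine c₁ p10)
  have hψ₂1 : ∀ y, ψ₂ y ≤ ψ₁ y := fun y => smin_le_left _ _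
  have hadm₂ : ∀ y, 0 < ψ₂ y → AdmissibleAt S ψ₂ y := by
    intro y hy
    have hpos : 0 < ψ₁ y := hy.trans_le (hψ₂1 y)
    refine admissibleAt_smin hS ((contDiff_affine c₁ p10).differentiable one_ne_zero)
      (hadm₁ y hpos) fun hlt => ?_
    rcases le_or_gt y.1 0 with h1 | h1
    · obtain ⟨k1, k2, k3⟩ := hbox₁ y hpos h1
      have := le_affine_of_mem_box M₁ Y₁ p10 y k2 k3
      linarith
    · exact admissibleAt_affine (by rw [sign_pos h1]; exact h10 _)
  set M₂ := c₁ + 1 / 2 with hM₂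
  have hM₂pos : 0 < M₂ := by linarith
  set Y₂ := Y₁ + M₂ / (-p10.1) + M₂ / (-p10.2) with hY₂
  have q1 : 0 < M₂ / (-p10.1) := div_pos hM₂pos (by linarith)
  have q2 : 0 < M₂ / (-p10.2) := div_pos hM₂pos (by linarith)
  have hbox₂ : ∀ y, 0 < ψ₂ y → (y.1 ≤ 0 ∨ 0 ≤ y.2) → ψ₂ y ≤ M₂ ∧ |y.1| ≤ Y₂ ∧ |y.2| ≤ Y₂ := by
    intro y hy hor
    rcases le_or_gt y.1 0 with h1 | h1
    · obtain ⟨k1, k2, k3⟩ := hbox₁ y (hy.trans_le (hψ₂1 y)) h1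
      exact ⟨by linarith [hψ₂1 y], by linarith, by linarith⟩
    · have h2 : 0 ≤ y.2 := hor.resolve_left (by linarith)
      have e1 : ψ₂ y ≤ _ := smin_le_right _ _
      rw [planeForm_apply] at e1
      have k1 : p10.1 * y.1 ≤ 0 := mul_nonpos_of_nonpos_of_nonneg ha10.le h1.le
      have k2 : p10.2 * y.2 ≤ 0 := mul_nonpos_of_nonpos_of_nonneg hb10.le h2
      have b1 : y.1 < M₂ / (-p10.1) := by rw [lt_div_iff₀ (by linarith)]; linarith
      have b2 : y.2 < M₂ / (-p10.2) := by rw [lt_div_iff₀ (by linarith)]; linarith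
      exact ⟨by linarith, abs_le.2 ⟨by linarith, by linarith⟩, abs_le.2 ⟨by linarith, by linarith⟩⟩
  set c₂ := M₂ + (|pq.1| + |pq.2|) * Y₂ with hc₂
  have hc₂M : M₂ ≤ c₂ := by
    have : 0 ≤ (|pq.1| + |pq.2|) * Y₂ := by positivity
    linarith
  refine ⟨fun y => smin (ψ₂ y) (c₂ + planeForm pq y), c₂ + 1 / 2,
    hψ₂C.smin (contDiff_affine c₂ pq), ?_, ?_, ?_⟩
  · refine le_smin (le_smin hψ₁z ?_) ?_ <;> (simp; linarith)
  · intro y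
    by_cases hor : y.1 ≤ 0 ∨ 0 ≤ y.2
    · refine (smin_le_left _ _).trans ?_
      rcases le_or_gt (ψ₂ y) 0 with hle | hpos
      · linarith
      · linarith [(hbox₂ y hpos hor).1]
    · push Not at hor
      refine (smin_le_right _ _).trans ?_
      have k1 : pq.1 * y.1 ≤ 0 := mul_nonpos_of_nonpos_of_nonneg haq.le hor.1.le
      have k2 : pq.2 * y.2 ≤ 0 := mul_nonpos_of_nonneg_of_nonpos hbq.le hor.2.le
      rw [planeForm_apply]; linarith
  · intro y hy
    have hpos : 0 < ψ₂ y := hy.trans_le (smin_le_left _ _)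
    refine admissibleAt_smin hS ((contDiff_affine c₂ pq).differentiable one_ne_zero)
      (hadm₂ y hpos) fun hlt => ?_
    by_cases hor : y.1 ≤ 0 ∨ 0 ≤ y.2
    · obtain ⟨k1, k2, k3⟩ := hbox₂ y hpos hor
      have := le_affine_of_mem_box M₂ Y₂ pq y k2 k3
      linarith
    · push Not at hor
      exact admissibleAt_affine (by rw [sign_pos hor.1, sign_neg hor.2]; exact hq)

/-- There is a bounded above `C¹` function on the plane, positive at the origin, which is
admissible at the points where it is positive. -/
def HasAdmissible (S : SignType → SignType → Set (ℝ × ℝ)) : Prop :=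
  ∃ (ψ : ℝ × ℝ → ℝ) (C : ℝ), ContDiff ℝ 1 ψ ∧ 1 ≤ ψ 0 ∧ (∀ y, ψ y ≤ C) ∧
    ∀ y, 0 < ψ y → AdmissibleAt S ψ y

/-- A family of convex sets of slopes indexed by the faces of the plane, together with a slope
`s σ τ` for each face which belongs to the sets of all adjacent faces and whose components point
inwards. -/
structure SlopeFamily (S : SignType → SignType → Set (ℝ × ℝ))
    (s : SignType → SignType → ℝ × ℝ) : Prop where
  convex : ∀ σ τ, Convex ℝ (S σ τ)
  mem : ∀ σ τ σ' τ', (σ = 0 ∨ σ = σ') → (τ = 0 ∨ τ = τ') → s σ τ ∈ S σ' τ'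
  fst_ne : ∀ σ τ, (s σ τ).1 ≠ 0
  snd_ne : ∀ σ τ, (s σ τ).2 ≠ 0
  fst_neg : ∀ σ τ : SignType, σ ≠ 0 → (σ : ℝ) * (s σ τ).1 < 0
  snd_neg : ∀ σ τ : SignType, τ ≠ 0 → (τ : ℝ) * (s σ τ).2 < 0

theorem SlopeFamily.swap {S : SignType → SignType → Set (ℝ × ℝ)}
    {s : SignType → SignType → ℝ × ℝ} (h : SlopeFamily S s) :
    SlopeFamily (fun σ τ => Prod.swap ⁻¹' S τ σ) (fun σ τ => (s τ σ).swap) where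
  convex σ τ := (h.convex τ σ).linear_preimage (LinearEquiv.prodComm ℝ ℝ ℝ).toLinearMap
  mem σ τ σ' τ' h1 h2 := h.mem τ σ τ' σ' h2 h1
  fst_ne σ τ := h.snd_ne τ σ
  snd_ne σ τ := h.fst_ne τ σ
  fst_neg σ τ := h.snd_neg τ σ
  snd_neg σ τ := h.fst_neg τ σ

theorem SlopeFamily.reflect {S : SignType → SignType → Set (ℝ × ℝ)}
    {s : SignType → SignType → ℝ × ℝ} (h : SlopeFamily S s) :
    SlopeFamily (fun σ τ => {g | (-g.1, g.2) ∈ S (-σ) τ})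
      (fun σ τ => (-(s (-σ) τ).1, (s (-σ) τ).2)) where
  convex σ τ := by
    intro x hx y hy a b ha hb hab
    have := h.convex (-σ) τ hx hy ha hb hab
    simp only [mem_ofPred_eq]
    convert this using 1
    ext
    · simp; ring
    · simp
  mem σ τ σ' τ' h1 h2 := by
    have := h.mem (-σ) τ (-σ') τ' (h1.imp (by rintro rfl; rfl) (by rintro rfl; rfl)) h2
    simpa using this
  fst_ne σ τ := neg_ne_zero.2 (h.fst_ne _ _)
  snd_ne σ τ := h.snd_ne _ _
  fst_neg σ τ hσ := by
    have := h.fst_neg (-σ) τ (by revert hσ; cases σ <;> decide)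
    cases σ <;> simp_all
  snd_neg σ τ := h.snd_neg _ _

theorem HasAdmissible.of_swap {S : SignType → SignType → Set (ℝ × ℝ)}
    (h : HasAdmissible (fun σ τ => Prod.swap ⁻¹' S τ σ)) : HasAdmissible S := by
  obtain ⟨ψ, C, h1, h2, h3, h4⟩ := h
  refine ⟨fun y => ψ (ContinuousLinearEquiv.prodComm ℝ ℝ ℝ y), C,
    h1.comp (ContinuousLinearEquiv.contDiff _), by simpa using h2, fun y => h3 _, ?_⟩
  intro y hy
  obtain ⟨g, hg, hd⟩ := h4 _ hy
  refine ⟨g.swap, hg, ?_⟩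
  refine (hd.comp y (ContinuousLinearEquiv.hasFDerivAt _)).congr_fderiv ?_
  ext <;> simp

theorem HasAdmissible.of_reflect {S : SignType → SignType → Set (ℝ × ℝ)}
    (h : HasAdmissible (fun σ τ => {g | (-g.1, g.2) ∈ S (-σ) τ})) : HasAdmissible S := by
  obtain ⟨ψ, C, h1, h2, h3, h4⟩ := h
  set L : ℝ × ℝ →L[ℝ] ℝ × ℝ :=
    (-ContinuousLinearMap.fst ℝ ℝ ℝ).prod (ContinuousLinearMap.snd ℝ ℝ ℝ) with hL
  refine ⟨fun y => ψ (L y), C, h1.comp L.contDiff, by simpa using h2, fun y => h3 _, ?_⟩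
  intro y hy
  obtain ⟨g, hg, hd⟩ := h4 _ hy
  refine ⟨(-g.1, g.2), ?_, ?_⟩
  · simpa [hL, Left.sign_neg] using hg
  · refine (hd.comp y L.hasFDerivAt).congr_fderiv ?_
    ext <;> simp [hL]

/-- The undetermined signs are those of `(s 1 0).2` and `(s 0 1).1`. If one is negative,
`exists_admissible_of_neg` applies, possibly after exchanging the axes; if both are positive,
`exists_admissible_of_pos_pos` does. -/
theorem SlopeFamily.hasAdmissible_of_pos {S : SignType → SignType → Set (ℝ × ℝ)}
    {s : SignType → SignType → ℝ × ℝ} (h : SlopeFamily S s) (ha : 0 < (s 0 0).1)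
    (hb : 0 < (s 0 0).2) : HasAdmissible S := by
  have key : ∀ {S : SignType → SignType → Set (ℝ × ℝ)} {s : SignType → SignType → ℝ × ℝ},
      SlopeFamily S s → 0 < (s 0 0).1 → 0 < (s 0 0).2 → (s 1 0).2 < 0 → HasAdmissible S := by
    intro S s h ha hb hneg
    have e1 := h.fst_neg 1 0 (by decide)
    have e2 := h.snd_neg 0 1 (by decide)
    have e3 := h.fst_neg (-1) 1 (by decide)
    have e4 := h.snd_neg (-1) 1 (by decide)
    have e5 := h.fst_neg 1 (-1) (by decide)
    have e6 := h.snd_neg 1 (-1) (by decide)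
    simp at e1 e2 e3 e4 e5 e6
    exact exists_admissible_of_neg h.convex (p := s 0 0) (p10 := s 1 0) (p01 := s 0 1)
      (pm := s (-1) 1) (pq := s 1 (-1)) (fun _ _ => h.mem _ _ _ _ (.inl rfl) (.inl rfl))
      (fun _ => h.mem _ _ _ _ (.inr rfl) (.inl rfl))
      (fun _ => h.mem _ _ _ _ (.inl rfl) (.inr rfl))
      (h.mem _ _ _ _ (.inr rfl) (.inr rfl)) (h.mem _ _ _ _ (.inr rfl) (.inr rfl))
      ha hb e1 hneg e2 e3 e4 e5 e6
  rcases lt_or_gt_of_ne (h.snd_ne 1 0) with h1 | h1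
  · exact key h ha hb h1
  rcases lt_or_gt_of_ne (h.fst_ne 0 1) with h2 | h2
  · exact (key h.swap hb ha h2).of_swap
  have e1 := h.fst_neg 1 0 (by decide)
  have e2 := h.snd_neg 0 1 (by decide)
  have e3 := h.fst_neg 1 1 (by decide)
  have e4 := h.snd_neg 1 1 (by decide)
  simp at e1 e2 e3 e4
  exact exists_admissible_of_pos_pos h.convex (p := s 0 0) (p10 := s 1 0) (p01 := s 0 1)
    (p11 := s 1 1) (fun _ _ => h.mem _ _ _ _ (.inl rfl) (.inl rfl))
    (fun _ => h.mem _ _ _ _ (.inr rfl) (.inl rfl))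
    (fun _ => h.mem _ _ _ _ (.inl rfl) (.inr rfl))
    (h.mem _ _ _ _ (.inr rfl) (.inr rfl)) ha hb e1 h1 h2 e2 e3 e4

/-- Reflections in the axes move `s 0 0` into the positive quadrant. -/
theorem SlopeFamily.hasAdmissible {S : SignType → SignType → Set (ℝ × ℝ)}
    {s : SignType → SignType → ℝ × ℝ} (h : SlopeFamily S s) : HasAdmissible S := by
  have key : ∀ {S : SignType → SignType → Set (ℝ × ℝ)} {s : SignType → SignType → ℝ × ℝ},
      SlopeFamily S s → 0 < (s 0 0).2 → HasAdmissible S := by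
    intro S s h hb
    rcases lt_or_gt_of_ne (h.fst_ne 0 0) with h1 | h1
    · exact (h.reflect.hasAdmissible_of_pos (by simpa using h1) (by simpa using hb)).of_reflect
    · exact h.hasAdmissible_of_pos h1 hb
  rcases lt_or_gt_of_ne (h.snd_ne 0 0) with h1 | h1
  · exact (key h.swap.reflect.swap (by simpa using h1)).of_swap.of_reflect.of_swap
  · exact key h h1

/-! ### Multipliers for sign constraints -/

/-- The closure of the set of reals of sign `τ`. -/
def signCone (τ : SignType) : Set ℝ := {t | (τ = 0 → t = 0) ∧ 0 ≤ (τ : ℝ) * t}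

theorem isClosed_signCone (τ : SignType) : IsClosed (signCone τ) := by
  refine IsClosed.and ?_ (isClosed_le continuous_const (by fun_prop))
  by_cases h : τ = 0
  · simp [h]
  · simp [h]

theorem convex_signCone (τ : SignType) : Convex ℝ (signCone τ) := by
  intro x hx y hy a b ha hb _
  refine ⟨fun h => by simp [hx.1 h, hy.1 h], ?_⟩
  have := mul_nonneg ha hx.2
  have := mul_nonneg hb hy.2
  simp only [smul_eq_mul]; linarith

theorem zero_mem_signCone (τ : SignType) : (0 : ℝ) ∈ signCone τ := by simp [signCone]

theorem mul_mem_signCone {τ : SignType} {t c : ℝ} (hc : 0 ≤ c) (h : t ∈ signCone τ) :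
    c * t ∈ signCone τ :=
  ⟨fun h0 => by simp [h.1 h0], by have := mul_nonneg hc h.2; linarith⟩

theorem coe_mem_signCone (τ : SignType) : (τ : ℝ) ∈ signCone τ := by
  cases τ <;> simp [signCone]

/-- A linear function bounded below on a cone generated by `x` is nonnegative at `x`. -/
theorem nonneg_of_forall_lt_mul {v x : ℝ} (h : ∀ c : ℝ, 0 ≤ c → v < c * x) : 0 ≤ x := by
  by_contra! hx
  have h0 := h 0 le_rfl
  rw [zero_mul] at h0
  have := h (v / x) (div_nonneg_of_nonpos h0.le hx.le)
  rw [div_mul_cancel₀ _ hx.ne] at this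
  exact lt_irrefl _ this

/-- Take `e = -τ`, or for `τ = 0` a sign agreeing with that of `x`. Nonvanishing components are what
the case analysis in the plane relies on. -/
theorem exists_strict_perturbation (τ : SignType) {x : ℝ} (h : (τ : ℝ) * x ≤ 0) :
    ∃ e : ℝ, |e| ≤ 1 ∧ ∀ κ : ℝ, 0 < κ → x + κ * e ≠ 0 ∧ (τ ≠ 0 → (τ : ℝ) * (x + κ * e) < 0) := by
  cases τ with
  | zero =>
    rcases le_total 0 x with hx | hx
    · exact ⟨1, by simp, fun κ hκ => ⟨by linarith, by simp⟩⟩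
    · exact ⟨-1, by simp, fun κ hκ => ⟨by linarith, by simp⟩⟩
  | neg =>
    simp at h
    exact ⟨1, by simp, fun κ hκ => ⟨by linarith, fun _ => by simp; linarith⟩⟩
  | pos =>
    simp at h
    exact ⟨-1, by simp, fun κ hκ => ⟨by linarith, fun _ => by simp; linarith⟩⟩

/-- Lagrange multipliers, with strict signs, for the positivity of an affine function on the part of
a compact convex set on which two linear forms satisfy sign constraints. -/
theorem exists_multiplier {V : Type*} [NormedAddCommGroup V] [NormedSpace ℝ V] {K : Set V}
    (hK : IsCompact K) (hKc : Convex ℝ K) (q : ℝ) (E l₁ l₂ : V →L[ℝ] ℝ) (τ₁ τ₂ : SignType)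
    (hpos : ∀ z ∈ K, l₁ z ∈ signCone τ₁ → l₂ z ∈ signCone τ₂ → 0 < q + E z) :
    ∃ s : ℝ × ℝ, s.1 ≠ 0 ∧ s.2 ≠ 0 ∧ (τ₁ ≠ 0 → (τ₁ : ℝ) * s.1 < 0) ∧
      (τ₂ ≠ 0 → (τ₂ : ℝ) * s.2 < 0) ∧ ∀ z ∈ K, 0 < q + E z + (s.1 * l₁ z + s.2 * l₂ z) := by
  set L : V →L[ℝ] ℝ × ℝ × ℝ := l₁.prod (l₂.prod E) with hL
  set W : Set (ℝ × ℝ × ℝ) := (fun z => (0, 0, q) + L z) '' K with hW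
  have hWcomp : IsCompact W := hK.image (by fun_prop)
  have hWconv : Convex ℝ W := by
    have := (hKc.linear_image L.toLinearMap).translate (0, 0, q)
    rwa [image_image] at this
  set C : Set (ℝ × ℝ × ℝ) := signCone τ₁ ×ˢ (signCone τ₂ ×ˢ Iic 0) with hC
  have hCclosed : IsClosed C :=
    (isClosed_signCone _).prod ((isClosed_signCone _).prod isClosed_Iic)
  have hCconv : Convex ℝ C := (convex_signCone _).prod ((convex_signCone _).prod (convex_Iic _))
  have hdisj : Disjoint W C := by
    rw [disjoint_left]
    rintro _ ⟨z, hz, rfl⟩ ⟨h1, h2, h3⟩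
    have := hpos z hz (by simpa [hL] using h1) (by simpa [hL] using h2)
    simp [hL] at h3
    linarith
  -- Separation in `ℝ³` of the compact image of `K` from the closed cone of admissible signs with
  -- nonpositive third coordinate. Boundedness below on the cone gives the signs of the
  -- coefficients.
  obtain ⟨f, u, v, hfu, huv, hvf⟩ :=
    geometric_hahn_banach_compact_closed hWconv hWcomp hCconv hCclosed hdisj
  set A₁ := -f (1, 0, 0) with hA₁
  set A₂ := -f (0, 1, 0) with hA₂
  set k := -f (0, 0, 1) with hk
  have hf : ∀ c : ℝ × ℝ × ℝ, f c = -(A₁ * c.1 + A₂ * c.2.1 + k * c.2.2) := by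
    intro c
    have : c = c.1 • ((1, 0, 0) : ℝ × ℝ × ℝ) + c.2.1 • ((0, 1, 0) : ℝ × ℝ × ℝ)
        + c.2.2 • ((0, 0, 1) : ℝ × ℝ × ℝ) := by ext <;> simp
    conv_lhs => rw [this]
    simp only [map_add, map_smul, smul_eq_mul, hA₁, hA₂, hk]; ring
  have hv0 : v < 0 := by
    have := hvf 0 ⟨zero_mem_signCone _, zero_mem_signCone _, by simp⟩
    simpa using this
  have hs₁ : (τ₁ : ℝ) * A₁ ≤ 0 := by
    have : 0 ≤ -((τ₁ : ℝ) * A₁) := nonneg_of_forall_lt_mul (v := v) fun c hc => by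
      have := hvf (c * τ₁, 0, 0) ⟨mul_mem_signCone hc (coe_mem_signCone _), zero_mem_signCone _,
        by simp⟩
      rw [hf] at this
      simp at this; linarith
    linarith
  have hs₂ : (τ₂ : ℝ) * A₂ ≤ 0 := by
    have : 0 ≤ -((τ₂ : ℝ) * A₂) := nonneg_of_forall_lt_mul (v := v) fun c hc => by
      have := hvf (0, c * τ₂, 0) ⟨zero_mem_signCone _, mul_mem_signCone hc (coe_mem_signCone _),
        by simp⟩
      rw [hf] at this
      simp at this; linarith
    linarith
  have hk0 : 0 ≤ k := nonneg_of_forall_lt_mul (v := v) fun c hc => by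
    have := hvf (0, 0, -c) ⟨zero_mem_signCone _, zero_mem_signCone _, by simpa using hc⟩
    rw [hf] at this
    simp at this; linarith
  obtain ⟨e₁, he₁, hp₁⟩ := exists_strict_perturbation τ₁ hs₁
  obtain ⟨e₂, he₂, hp₂⟩ := exists_strict_perturbation τ₂ hs₂
  obtain ⟨B, hBpos, hB⟩ := hWcomp.isBounded.exists_pos_norm_le
  -- The separation margin exceeds `-v = 4κB`, while the three perturbed coefficients cost at most
  -- `3κB`. Perturbing `k` as well makes the division by `k + κ` legitimate even when `k = 0`.
  set κ := -v / (4 * B) with hκ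
  have hκpos : 0 < κ := div_pos (by linarith) (by linarith)
  have hκB : 4 * (κ * B) = -v := by rw [hκ]; field_simp
  have hkκ : 0 < k + κ := by linarith
  have hquot : ∀ {τ : SignType} {x : ℝ}, (τ : ℝ) * x < 0 → (τ : ℝ) * (x / (k + κ)) < 0 := by
    intro τ x h
    rw [← mul_div_assoc]
    exact div_neg_of_neg_of_pos h hkκ
  refine ⟨((A₁ + κ * e₁) / (k + κ), (A₂ + κ * e₂) / (k + κ)),
    div_ne_zero (hp₁ κ hκpos).1 hkκ.ne', div_ne_zero (hp₂ κ hκpos).1 hkκ.ne',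
    fun h => hquot ((hp₁ κ hκpos).2 h), fun h => hquot ((hp₂ κ hκpos).2 h), fun z hz => ?_⟩
  have hzW : (0, 0, q) + L z ∈ W := ⟨z, hz, rfl⟩
  have h1 := hfu _ hzW
  rw [hf] at h1
  have h2 := hB _ hzW
  simp [hL] at h1 h2
  obtain ⟨b1, b2, b3⟩ := h2
  have m1 : |e₁ * l₁ z| ≤ B := by
    rw [abs_mul]; nlinarith [abs_nonneg (l₁ z), abs_nonneg e₁]
  have m2 : |e₂ * l₂ z| ≤ B := by
    rw [abs_mul]; nlinarith [abs_nonneg (l₂ z), abs_nonneg e₂]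
  have m1' := mul_le_mul_of_nonneg_left (abs_le.1 m1).1 hκpos.le
  have m2' := mul_le_mul_of_nonneg_left (abs_le.1 m2).1 hκpos.le
  have m3' := mul_le_mul_of_nonneg_left (abs_le.1 b3).1 hκpos.le
  have : q + E z + ((A₁ + κ * e₁) / (k + κ) * l₁ z + (A₂ + κ * e₂) / (k + κ) * l₂ z) =
      ((k + κ) * (q + E z) + (A₁ + κ * e₁) * l₁ z + (A₂ + κ * e₂) * l₂ z) / (k + κ) := by
    field_simp
    ring
  simp only [this]
  refine div_pos ?_ hkκ
  linarith

/-! ### Local structure of a multi-domain -/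

namespace MultiDomain

variable {d : ℕ} (D : MultiDomain d)

theorem continuous_sub_offset (j : Fin D.q) :
    Continuous fun x : Euc d => inner ℝ (D.normal j) x - D.offset j := by fun_prop

theorem convex_face (σ : Fin D.q → SignType) : Convex ℝ (D.face σ) := by
  have : D.face σ = ⋂ j, {x | SignType.sign (inner ℝ (D.normal j) x - D.offset j) = σ j} := by
    ext x; simp [face]
  rw [this]
  refine convex_iInter fun j => ?_
  have hlin : IsLinearMap ℝ fun x : Euc d => inner ℝ (D.normal j) x :=
    ⟨fun x y => inner_add_right _ _ _, fun c x => by simp [inner_smul_right]⟩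
  cases h : σ j with
  | zero => simpa [sign_eq_zero_iff, sub_eq_zero] using convex_hyperplane hlin (D.offset j)
  | neg =>
    simpa [sign_eq_neg_one_iff, sub_neg] using convex_halfSpace_lt hlin (D.offset j)
  | pos =>
    simpa [sign_eq_one_iff, sub_pos] using convex_halfSpace_gt hlin (D.offset j)

/-- Signs are constant on a cell because it is connected and misses `Γ`; conversely a face off `Γ`
is convex, hence connected, and is covered by the disjoint open cells. -/
theorem face_mem_range_Ω {σ : Fin D.q → SignType} (hne : (D.face σ).Nonempty)
    (hσ : ∀ j, σ j ≠ 0) : D.face σ ∈ range D.Ω := by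
  have hface : ∀ x ∈ D.face σ, x ∉ ⋃ j, {x : Euc d | inner ℝ (D.normal j) x = D.offset j} := by
    intro x hx hmem
    obtain ⟨j, hj⟩ := mem_iUnion.1 hmem
    have := hx j
    rw [sub_eq_zero.2 hj, sign_zero] at this
    exact hσ j this.symm
  have hcov : ∀ x ∈ D.face σ, ∃ i, x ∈ D.Ω i := by
    intro x hx
    have : x ∈ (univ : Set (Euc d)) := mem_univ x
    rw [← D.cover] at this
    exact mem_iUnion.1 (this.resolve_left (hface x hx))
  obtain ⟨x, hx⟩ := hne
  obtain ⟨i, hi⟩ := hcov x hx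
  refine ⟨i, Subset.antisymm ?_ ?_⟩
  · intro y hy j
    rw [← hx j]
    refine (D.isConnected_Ω i).isPreconnected.constant
      (f := fun z => SignType.sign (inner ℝ (D.normal j) z - D.offset j)) ?_ hy hi
    intro z hz
    refine ContinuousAt.continuousWithinAt ?_
    refine (continuousAt_sign_of_ne_zero ?_).comp (D.continuous_sub_offset j).continuousAt
    intro h0
    have : z ∈ (⋃ j, {x : Euc d | inner ℝ (D.normal j) x = D.offset j}) ∩ D.Ω i :=
      ⟨mem_iUnion.2 ⟨j, sub_eq_zero.1 h0⟩, hz⟩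
    rw [D.inter_eq_empty i] at this
    exact this
  · refine (D.convex_face σ).isPreconnected.subset_left_of_subset_union (D.isOpen_Ω i)
      (isOpen_iUnion fun k => isOpen_iUnion fun _ : k ≠ i => D.isOpen_Ω k) ?_ ?_ ⟨x, hx, hi⟩
    · simp only [disjoint_iUnion_right]
      exact fun k hk => D.disjoint_Ω i k hk.symm
    · intro y hy
      obtain ⟨k, hk⟩ := hcov y hy
      by_cases hki : k = i
      · exact .inl (hki ▸ hk)
      · exact .inr (mem_iUnion₂.2 ⟨k, hki, hk⟩)

theorem face_mem_strata {σ : Fin D.q → SignType} (hne : (D.face σ).Nonempty) :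
    D.face σ ∈ D.strata := by
  by_cases h : ∃ j, σ j = 0
  · exact .inr ⟨hne, σ, h, rfl⟩
  · push Not at h
    exact .inl (D.face_mem_range_Ω hne h)

open Classical in
/-- The normal of the hyperplanes of the `i`-th family through `x₀`, or `0` if there are none. -/
noncomputable def localNormal (x₀ : Euc d) (i : Fin 2) : Euc d :=
  if h : ∃ j, D.family j = i ∧ inner ℝ (D.normal j) x₀ = D.offset j then D.normal h.choose else 0

open Classical in
/-- The face adjacent to `x₀` having prescribed positions with respect to the hyperplanes
through `x₀`. -/
noncomputable def localFace (x₀ : Euc d) (τ : Fin 2 → SignType) : Set (Euc d) :=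
  D.face fun j => if inner ℝ (D.normal j) x₀ = D.offset j then τ (D.family j)
    else SignType.sign (inner ℝ (D.normal j) x₀ - D.offset j)

/-- A direction pointing from `x₀` into `D.localFace x₀ τ`. -/
noncomputable def localDir (x₀ : Euc d) (τ : Fin 2 → SignType) : Euc d :=
  (τ 0 : ℝ) • D.localNormal x₀ 0 + (τ 1 : ℝ) • D.localNormal x₀ 1

variable {D} {x₀ : Euc d}

theorem localNormal_family {j : Fin D.q} (h : inner ℝ (D.normal j) x₀ = D.offset j) :
    D.localNormal x₀ (D.family j) = D.normal j := by
  have hex : ∃ k, D.family k = D.family j ∧ inner ℝ (D.normal k) x₀ = D.offset k := ⟨j, rfl, h⟩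
  rw [localNormal, dif_pos hex]
  exact D.normal_eq _ _ hex.choose_spec.1

theorem localNormal_eq (x₀ : Euc d) (i : Fin 2) : D.localNormal x₀ i = 0 ∨
    ∃ j, D.family j = i ∧ inner ℝ (D.normal j) x₀ = D.offset j ∧
      D.localNormal x₀ i = D.normal j := by
  by_cases hex : ∃ j, D.family j = i ∧ inner ℝ (D.normal j) x₀ = D.offset j
  · exact .inr ⟨hex.choose, hex.choose_spec.1, hex.choose_spec.2, by rw [localNormal, dif_pos hex]⟩
  · exact .inl (by rw [localNormal, dif_neg hex])

theorem norm_localNormal (x₀ : Euc d) (i : Fin 2) :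
    D.localNormal x₀ i = 0 ∨ ‖D.localNormal x₀ i‖ = 1 := by
  rcases D.localNormal_eq x₀ i with h | ⟨j, -, -, h⟩
  · exact .inl h
  · exact .inr (by rw [h, D.norm_normal])

theorem inner_localNormal {i k : Fin 2} (hik : i ≠ k) :
    inner ℝ (D.localNormal x₀ i) (D.localNormal x₀ k) = 0 := by
  rcases D.localNormal_eq x₀ i with h | ⟨j, hj, -, h⟩
  · simp [h]
  rcases D.localNormal_eq x₀ k with h' | ⟨j', hj', -, h'⟩
  · simp [h']
  rw [h, h']
  exact D.normal_orthogonal _ _ (by rw [hj, hj']; exact hik)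

theorem inner_localNormal_localDir (i : Fin 2) (τ : Fin 2 → SignType) :
    D.localNormal x₀ i = 0 ∨
      inner ℝ (D.localNormal x₀ i) (D.localDir x₀ τ) = (τ i : ℝ) := by
  refine (D.norm_localNormal x₀ i).imp_right fun h => ?_
  fin_cases i
  · simp only [Fin.zero_eta] at h
    simp [localDir, inner_add_right, inner_smul_right, inner_localNormal (D := D) (x₀ := x₀)
      (zero_ne_one : (0 : Fin 2) ≠ 1), h]
  · simp only [Fin.mk_one] at h
    simp [localDir, inner_add_right, inner_smul_right, inner_localNormal (D := D) (x₀ := x₀)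
      (one_ne_zero : (1 : Fin 2) ≠ 0), h]

/-- Near `x₀`, the local faces are determined by the signs of the inner products with the normals
of the hyperplanes through `x₀`. -/
theorem eventually_mem_localFace (D : MultiDomain d) (x₀ : Euc d) :
    ∀ᶠ w in 𝓝 (0 : Euc d), ∀ τ : Fin 2 → SignType,
      (∀ i, D.localNormal x₀ i = 0 ∨ SignType.sign (inner ℝ (D.localNormal x₀ i) w) = τ i) →
      x₀ + w ∈ D.localFace x₀ τ := by
  have hev : ∀ᶠ w in 𝓝 (0 : Euc d), ∀ j, inner ℝ (D.normal j) x₀ ≠ D.offset j →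
      SignType.sign (inner ℝ (D.normal j) (x₀ + w) - D.offset j) =
        SignType.sign (inner ℝ (D.normal j) x₀ - D.offset j) := by
    refine eventually_all.2 fun j => ?_
    by_cases hj : inner ℝ (D.normal j) x₀ = D.offset j
    · exact Eventually.of_forall fun w h => absurd hj h
    · have hc : ContinuousAt (fun w : Euc d =>
          SignType.sign (inner ℝ (D.normal j) (x₀ + w) - D.offset j)) 0 := by
        refine ContinuousAt.comp (g := SignType.sign)
          (f := fun w : Euc d => inner ℝ (D.normal j) (x₀ + w) - D.offset j)
          (continuousAt_sign_of_ne_zero ?_) (by fun_prop)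
        simpa [sub_eq_zero] using hj
      have := hc.eventually (eventually_of_mem ((isOpen_discrete
        {SignType.sign (inner ℝ (D.normal j) (x₀ + 0) - D.offset j)}).mem_nhds rfl)
        fun _ h => h)
      filter_upwards [this] with w hw _
      simpa using hw
  filter_upwards [hev] with w hw τ hτ j
  beta_reduce
  by_cases hj : inner ℝ (D.normal j) x₀ = D.offset j
  · rw [if_pos hj, inner_add_right, hj, add_sub_cancel_left, ← localNormal_family hj]
    refine (hτ (D.family j)).resolve_left fun h => ?_
    have := D.norm_normal j
    rw [← localNormal_family hj, h, norm_zero] at this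
    exact zero_ne_one this
  · rw [if_neg hj]
    exact hw j hj

theorem sign_add_smul {τ σ : SignType} (h : τ = 0 ∨ τ = σ) {δ κ : ℝ} (hδ : 0 ≤ δ) (hκ : 0 < κ) :
    SignType.sign (δ * (τ : ℝ) + κ * (σ : ℝ)) = σ := by
  rcases h with rfl | rfl
  · cases σ <;> simp [hκ]
  · cases τ
    · simp
    · simp only [SignType.neg_eq_neg_one, SignType.coe_neg_one, sign_eq_neg_one_iff]; linarith
    · simp only [SignType.pos_eq_one, SignType.coe_one, sign_eq_one_iff]; linarith

theorem sign_inner_localDir {τ σ : Fin 2 → SignType} (h : ∀ i, τ i = 0 ∨ τ i = σ i)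
    {δ κ : ℝ} (hδ : 0 ≤ δ) (hκ : 0 < κ) (i : Fin 2) :
    D.localNormal x₀ i = 0 ∨ SignType.sign (inner ℝ (D.localNormal x₀ i)
      (δ • D.localDir x₀ τ + κ • D.localDir x₀ σ)) = σ i := by
  rcases D.inner_localNormal_localDir (x₀ := x₀) i τ with h0 | h1
  · exact .inl h0
  rcases D.inner_localNormal_localDir (x₀ := x₀) i σ with h0 | h2
  · exact .inl h0
  right
  rw [inner_add_right, inner_smul_right, inner_smul_right, h1, h2]
  exact sign_add_smul (h i) hδ hκ

theorem eventually_localDir_mem (D : MultiDomain d) (x₀ : Euc d) (τ : Fin 2 → SignType) :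
    ∀ᶠ κ in 𝓝[>] (0 : ℝ), x₀ + κ • D.localDir x₀ τ ∈ D.localFace x₀ τ := by
  have ht : Tendsto (fun κ : ℝ => κ • D.localDir x₀ τ) (𝓝[>] 0) (𝓝 0) := by
    have : Continuous fun κ : ℝ => κ • D.localDir x₀ τ := by fun_prop
    exact (this.tendsto' 0 0 (zero_smul _ _)).mono_left nhdsWithin_le_nhds
  filter_upwards [ht.eventually (D.eventually_mem_localFace x₀), self_mem_nhdsWithin] with κ h hκ
  refine h τ fun i => ?_
  have := sign_inner_localDir (D := D) (x₀ := x₀) (τ := τ) (σ := τ) (fun i => .inr rfl) le_rfl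
    (mem_Ioi.1 hκ) i
  simpa using this

theorem localFace_mem_strata (D : MultiDomain d) (x₀ : Euc d) (τ : Fin 2 → SignType) :
    D.localFace x₀ τ ∈ D.strata := by
  obtain ⟨κ, hκ⟩ := (D.eventually_localDir_mem x₀ τ).exists
  exact D.face_mem_strata ⟨_, hκ⟩

theorem mem_closure_localFace (D : MultiDomain d) (x₀ : Euc d) (τ : Fin 2 → SignType) :
    x₀ ∈ closure (D.localFace x₀ τ) := by
  have ht : Tendsto (fun κ : ℝ => x₀ + κ • D.localDir x₀ τ) (𝓝[>] 0) (𝓝 x₀) := by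
    have : Continuous fun κ : ℝ => x₀ + κ • D.localDir x₀ τ := by fun_prop
    exact (this.tendsto' 0 x₀ (by simp)).mono_left nhdsWithin_le_nhds
  exact mem_closure_of_tendsto ht (D.eventually_localDir_mem x₀ τ)

theorem sign_add_of_mem_signCone {τ : SignType} {t κ : ℝ} (ht : t ∈ signCone τ) (hκ : 0 < κ) :
    SignType.sign (t + κ * (τ : ℝ)) = τ := by
  cases τ
  · simp [ht.1]
  · have := ht.2
    simp at this
    simp only [SignType.neg_eq_neg_one, SignType.coe_neg_one, sign_eq_neg_one_iff]; linarith
  · have := ht.2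
    simp at this
    simp only [SignType.pos_eq_one, SignType.coe_one, sign_eq_one_iff]; linarith

/-- A small step along `v` stays in the closed face, since adding a little of `localDir` makes all
sign conditions strict. The distance quotient is therefore eventually zero. -/
theorem mem_tangentConeOf_localFace {τ : Fin 2 → SignType} {v : Euc d}
    (hv : ∀ i, inner ℝ (D.localNormal x₀ i) v ∈ signCone (τ i)) :
    v ∈ tangentConeOf (closure (D.localFace x₀ τ)) x₀ := by
  obtain ⟨r, hr, hball⟩ := Metric.eventually_nhds_iff_ball.1 (D.eventually_mem_localFace x₀)
  have hev : ∀ᶠ t in 𝓝[>] (0 : ℝ), x₀ + t • v ∈ closure (D.localFace x₀ τ) := by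
    have ht : Tendsto (fun t : ℝ => t • v) (𝓝[>] 0) (𝓝 0) := by
      have : Continuous fun t : ℝ => t • v := by fun_prop
      exact (this.tendsto' 0 0 (zero_smul _ _)).mono_left nhdsWithin_le_nhds
    filter_upwards [ht.eventually (Metric.ball_mem_nhds 0 hr), self_mem_nhdsWithin] with t h1 h2
    have hκ : Tendsto (fun κ : ℝ => t • v + κ • D.localDir x₀ τ) (𝓝[>] 0) (𝓝 (t • v)) := by
      have : Continuous fun κ : ℝ => t • v + κ • D.localDir x₀ τ := by fun_prop
      exact (this.tendsto' 0 _ (by simp)).mono_left nhdsWithin_le_nhds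
    refine mem_closure_of_tendsto (hκ.const_add x₀) ?_
    filter_upwards [hκ.eventually (Metric.isOpen_ball.mem_nhds h1), self_mem_nhdsWithin]
      with κ h3 h4
    refine hball _ h3 τ fun i => ?_
    refine (D.inner_localNormal_localDir (x₀ := x₀) i τ).imp_right fun h5 => ?_
    rw [inner_add_right, inner_smul_right, inner_smul_right, h5]
    exact sign_add_of_mem_signCone (mul_mem_signCone (le_of_lt (mem_Ioi.1 h2)) (hv i))
      (mem_Ioi.1 h4)
  refine Tendsto.liminf_eq ?_
  refine tendsto_const_nhds.congr' ?_
  filter_upwards [hev] with t ht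
  rw [Metric.infDist_zero_of_mem ht, zero_div]

end MultiDomain

/-! ### Limit dynamics on the faces adjacent to a point -/

section LimitDynamics

variable {d N : ℕ} {D : MultiDomain d} {A : Set (Euc N)} {f : Euc d → Euc N → Euc d}
  {c : ℝ} {K : ℝ → ℝ}

/-- A limit along one sequence in `M` is approximated at every nearby point of `M`, by comparing
that point with a late term of the sequence through the Lipschitz bound. -/
theorem exists_dynamics_dist_lt (hF : HF D A f c K) {M : Set (Euc d)} (hM : M ∈ D.strata)
    {x₀ v : Euc d} (hv : v ∈ extDynamics A f M x₀) {R : ℝ} (hx₀ : ‖x₀‖ < R) {x : Euc d}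
    (hx : x ∈ M) (hxR : ‖x‖ ≤ R) {δ : ℝ} (hδ : 0 < δ) :
    ∃ w ∈ dynamics A f x, dist v w < |K R| * dist x₀ x + δ := by
  -- The first bound keeps the comparison point in the ball of radius `R`; the second makes the
  -- approximation and Lipschitz errors together at most `δ / 3`.
  set ε := min (R - ‖x₀‖) (δ / (3 * (1 + |K R|))) with hε
  have hKpos : 0 < 1 + |K R| := by positivity
  have hεpos : 0 < ε := lt_min (by linarith) (by positivity)
  have hε1 : ε ≤ R - ‖x₀‖ := min_le_left _ _
  have hε2 : ε * (1 + |K R|) ≤ δ / 3 := by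
    have : ε ≤ δ / 3 / (1 + |K R|) := (min_le_right _ _).trans_eq (by rw [div_div])
    rwa [le_div_iff₀ hKpos] at this
  obtain ⟨⟨y, p⟩, ⟨hyM, hp⟩, hdist⟩ := Metric.mem_closure_iff.1 hv ε hεpos
  rw [Prod.dist_eq, max_lt_iff] at hdist
  obtain ⟨hd1, hd2⟩ := hdist
  simp only at hyM hp hd1 hd2
  have hyR : ‖y‖ ≤ R := by
    have h1 := norm_le_norm_add_norm_sub' y x₀
    rw [← dist_eq_norm, dist_comm] at h1
    linarith
  have hlip := hF.lipschitz M hM R y ⟨hyM, by simpa using hyR⟩ x ⟨hx, by simpa using hxR⟩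
  have hyx : dist y x ≤ ε + dist x₀ x := by
    have := dist_triangle y x₀ x
    rw [dist_comm y x₀] at this
    linarith
  have hle : K R * dist y x ≤ |K R| * (ε + dist x₀ x) :=
    (mul_le_mul_of_nonneg_right (le_abs_self _) dist_nonneg).trans
      (mul_le_mul_of_nonneg_left hyx (abs_nonneg _))
  have hlt : Metric.hausdorffDist (dynamics A f y) (dynamics A f x) <
      |K R| * (ε + dist x₀ x) + δ / 3 := by linarith
  obtain ⟨w, hw, hpw⟩ := Metric.exists_dist_lt_of_hausdorffDist_lt hp hlt
    (Metric.hausdorffEDist_ne_top_of_nonempty_of_bounded (hF.nonempty y) (hF.nonempty x)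
      (hF.isCompact y).isBounded (hF.isCompact x).isBounded)
  refine ⟨w, hw, ?_⟩
  have := dist_triangle v p w
  linarith

theorem isClosed_extDynamics (A : Set (Euc N)) (f : Euc d → Euc N → Euc d) (M : Set (Euc d))
    (x : Euc d) : IsClosed (extDynamics A f M x) :=
  isClosed_closure.preimage (by fun_prop : Continuous fun v : Euc d => (x, v))

/-- Points of a local face, arbitrarily close to `x₀`, at which limit dynamics are approximated. -/
theorem eventually_exists_dynamics_dist_lt (hF : HF D A f c K) (x₀ : Euc d)
    (τ : Fin 2 → SignType) {ε : ℝ} (hε : 0 < ε) :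
    ∀ᶠ x in 𝓝 x₀, x ∈ D.localFace x₀ τ → ∀ v ∈ extDynamics A f (D.localFace x₀ τ) x₀,
      ∃ w ∈ dynamics A f x, dist v w < ε := by
  set R := ‖x₀‖ + 1 with hR
  have h1 : ∀ᶠ x in 𝓝 x₀, ‖x‖ < R :=
    continuous_norm.continuousAt.eventually (Iio_mem_nhds (by linarith))
  have h2 : ∀ᶠ x in 𝓝 x₀, |K R| * dist x₀ x < ε / 2 := by
    have : Continuous fun x => |K R| * dist x₀ x := by fun_prop
    exact this.continuousAt.eventually (Iio_mem_nhds (by simpa using hε))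
  filter_upwards [h1, h2] with x hx1 hx2 hxM v hv
  obtain ⟨w, hw, hvw⟩ := exists_dynamics_dist_lt hF (D.localFace_mem_strata x₀ τ) hv
    (by linarith : ‖x₀‖ < R) hxM hx1.le (half_pos hε)
  exact ⟨w, hw, by linarith⟩

/-- Two limit velocities can be approximated at the same point of the face, where the dynamics are
convex. -/
theorem convex_extDynamics (hF : HF D A f c K) (hconv : ∀ x, Convex ℝ (dynamics A f x))
    (x₀ : Euc d) (τ : Fin 2 → SignType) :
    Convex ℝ (extDynamics A f (D.localFace x₀ τ) x₀) := by
  intro v₁ hv₁ v₂ hv₂ a b ha hb hab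
  refine Metric.mem_closure_iff.2 fun ε hε => ?_
  have hev := eventually_exists_dynamics_dist_lt hF x₀ τ hε
  obtain ⟨x, ⟨hx, hdist⟩, hxM⟩ := mem_closure_iff_nhds.1 (D.mem_closure_localFace x₀ τ) _
    (hev.and (Metric.ball_mem_nhds x₀ hε))
  obtain ⟨w₁, hw₁, hd₁⟩ := hx hxM v₁ hv₁
  obtain ⟨w₂, hw₂, hd₂⟩ := hx hxM v₂ hv₂
  refine ⟨(x, a • w₁ + b • w₂), ⟨hxM, hconv x hw₁ hw₂ ha hb hab⟩, ?_⟩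
  rw [Prod.dist_eq, max_lt_iff]
  refine ⟨by rw [dist_comm]; exact hdist, ?_⟩
  have : a • v₁ + b • v₂ - (a • w₁ + b • w₂) = a • (v₁ - w₁) + b • (v₂ - w₂) := by module
  have hball := (convex_ball (0 : Euc d) ε) (x := v₁ - w₁) (y := v₂ - w₂)
    (by simpa [dist_eq_norm] using hd₁) (by simpa [dist_eq_norm] using hd₂) ha hb hab
  rw [dist_eq_norm, this]
  simpa using hball

theorem eventually_dynamics_subset_thickening (hF : HF D A f c K) (x : Euc d) {ε : ℝ}
    (hε : 0 < ε) :
    ∀ᶠ y in 𝓝 x, dynamics A f y ⊆ Metric.thickening ε (dynamics A f x) := by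
  have := upperHemicontinuousAt_iff.1 (hF.usc x) (Metric.thickening ε (dynamics A f x))
    (Metric.isOpen_thickening.mem_nhdsSet.2 (Metric.self_subset_thickening hε _))
  filter_upwards [this] with y hy
  exact subset_of_mem_nhdsSet hy

/-- Step from `x₀` into the face `τ`, then by a much smaller amount into `σ`. The velocity is
approximated at the second point, and upper semicontinuity at the first carries it over to the face
`τ`. -/
theorem extDynamics_localFace_subset (hF : HF D A f c K) (x₀ : Euc d) {τ σ : Fin 2 → SignType}
    (h : ∀ i, τ i = 0 ∨ τ i = σ i) :
    extDynamics A f (D.localFace x₀ σ) x₀ ⊆ extDynamics A f (D.localFace x₀ τ) x₀ := by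
  intro v hv
  refine Metric.mem_closure_iff.2 fun ε hε => ?_
  obtain ⟨r, hr, hball⟩ := Metric.eventually_nhds_iff_ball.1 (D.eventually_mem_localFace x₀)
  obtain ⟨ρ, hρ, hnear⟩ := Metric.eventually_nhds_iff_ball.1
    (eventually_exists_dynamics_dist_lt hF x₀ σ (half_pos hε))
  have ht : Tendsto (fun δ : ℝ => δ • D.localDir x₀ τ) (𝓝[>] 0) (𝓝 0) := by
    have : Continuous fun δ : ℝ => δ • D.localDir x₀ τ := by fun_prop
    exact (this.tendsto' 0 0 (zero_smul _ _)).mono_left nhdsWithin_le_nhds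
  have hpos : 0 < min ε (min r ρ) := lt_min hε (lt_min hr hρ)
  obtain ⟨δ, ⟨hδτ, hδball⟩, hδ⟩ := ((D.eventually_localDir_mem x₀ τ).and
    (ht.eventually (Metric.ball_mem_nhds 0 hpos))).and self_mem_nhdsWithin |>.exists
  set w := δ • D.localDir x₀ τ with hw
  have hκ : Tendsto (fun κ : ℝ => w + κ • D.localDir x₀ σ) (𝓝[>] 0) (𝓝 w) := by
    have : Continuous fun κ : ℝ => w + κ • D.localDir x₀ σ := by fun_prop
    exact (this.tendsto' 0 _ (by simp)).mono_left nhdsWithin_le_nhds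
  obtain ⟨κ, ⟨hκball, hκusc⟩, hκpos⟩ := ((hκ.eventually (Metric.isOpen_ball.mem_nhds hδball)).and
    ((hκ.const_add x₀).eventually (eventually_dynamics_subset_thickening hF (x₀ + w)
      (half_pos hε)))).and self_mem_nhdsWithin |>.exists
  set w' := w + κ • D.localDir x₀ σ with hw'
  have hnorm : ‖w‖ < min ε (min r ρ) := by simpa using hδball
  have hnorm' : ‖w'‖ < min ε (min r ρ) := by simpa using hκball
  simp only [lt_min_iff] at hnorm hnorm'
  have hmem : x₀ + w' ∈ D.localFace x₀ σ :=
    hball w' (by simpa using hnorm'.2.1) σ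
      (MultiDomain.sign_inner_localDir h (le_of_lt (mem_Ioi.1 hδ)) (mem_Ioi.1 hκpos))
  obtain ⟨p, hp, hvp⟩ := hnear (x₀ + w') (by simpa using hnorm'.2.2) hmem v hv
  obtain ⟨p', hp', hpp'⟩ := Metric.mem_thickening_iff.1 (hκusc hp)
  refine ⟨(x₀ + w, p'), ⟨hδτ, hp'⟩, ?_⟩
  rw [Prod.dist_eq, max_lt_iff]
  refine ⟨by simpa using hnorm.1, ?_⟩
  have := dist_triangle v p p'
  simp only
  linarith

/-- A strict inequality on the values at `x₀` with limit dynamics in a face holds, up to a constant,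
at all the points close to `x₀` which lie in the faces adjacent to that face. -/
theorem eventually_forall_le_of_pos (hF : HF D A f c K) {G : Euc d → Set (Euc d × ℝ)}
    (hGF : ∀ x, ∀ z ∈ G x, z.1 ∈ dynamics A f x) {x₀ : Euc d} (hGc : IsCompact (G x₀))
    (hG : UpperHemicontinuousAt G x₀) {e : Euc d × ℝ → ℝ} (he : Continuous e)
    {τ : Fin 2 → SignType}
    (hpos : ∀ z ∈ G x₀, z.1 ∈ extDynamics A f (D.localFace x₀ τ) x₀ → 0 < e z) :
    ∃ η > 0, ∀ᶠ x in 𝓝 x₀,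
      (∀ i, τ i = 0 ∨ τ i = SignType.sign (inner ℝ (D.localNormal x₀ i) (x - x₀))) →
      ∀ z ∈ G x, η ≤ e z := by
  have hcomp : IsCompact (G x₀ ∩ {z | z.1 ∈ extDynamics A f (D.localFace x₀ τ) x₀}) :=
    hGc.inter_right ((isClosed_extDynamics A f _ x₀).preimage continuous_fst)
  obtain ⟨η, hη, hlt⟩ : ∃ η > 0, ∀ z ∈ G x₀,
      z.1 ∈ extDynamics A f (D.localFace x₀ τ) x₀ → η < e z := by
    rcases (G x₀ ∩ {z | z.1 ∈ extDynamics A f (D.localFace x₀ τ) x₀}).eq_empty_or_nonempty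
      with h | h
    · exact ⟨1, one_pos, fun z h1 h2 => (eq_empty_iff_forall_notMem.1 h z ⟨h1, h2⟩).elim⟩
    · obtain ⟨z₀, hz₀, hmin⟩ := hcomp.exists_isMinOn h he.continuousOn
      have h0 := hpos z₀ hz₀.1 hz₀.2
      exact ⟨e z₀ / 2, half_pos h0, fun z h1 h2 =>
        (half_lt_self h0).trans_le (hmin ⟨h1, h2⟩)⟩
  refine ⟨η, hη, ?_⟩
  have key : ∀ σ : Fin 2 → SignType, ∀ᶠ x in 𝓝 x₀, (∀ i, τ i = 0 ∨ τ i = σ i) →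
      x ∈ D.localFace x₀ σ → ∀ z ∈ G x, η ≤ e z := by
    intro σ
    by_cases hσ : ∀ i, τ i = 0 ∨ τ i = σ i
    swap
    · exact Eventually.of_forall fun x h => absurd h hσ
    set gr := closure {z : Euc d × Euc d | z.1 ∈ D.localFace x₀ σ ∧ z.2 ∈ dynamics A f z.1}
      with hgr
    -- The bad values at `x₀` form a compact set whose velocities avoid the limit dynamics of `σ`. A
    -- tube around it misses the closed graph `gr`, so no value of `G` at a nearby point of the face
    -- `σ` can enter it.
    have hC : IsCompact (G x₀ ∩ {z | e z ≤ η}) :=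
      hGc.inter_right (isClosed_le he continuous_const)
    have hopen : IsOpen {p : Euc d × (Euc d × ℝ) | (p.1, p.2.1) ∉ gr} :=
      (isClosed_closure.preimage (by fun_prop :
        Continuous fun p : Euc d × (Euc d × ℝ) => (p.1, p.2.1))).isOpen_compl
    obtain ⟨U, V, hU, hV, hxU, hCV, hUV⟩ := generalized_tube_lemma
      (isCompact_singleton (x := x₀)) hC hopen (by
        rintro ⟨x, z⟩ ⟨hx, hz, hez⟩ hmem
        rw [mem_singleton_iff] at hx
        simp only at hx hmem
        subst hx
        exact absurd (hlt z hz (extDynamics_localFace_subset hF x hσ hmem)) (not_lt.2 hez))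
    have husc := upperHemicontinuousAt_iff.1 hG (V ∪ {z | η < e z})
      ((hV.union (isOpen_lt continuous_const he)).mem_nhdsSet.2 fun z hz => by
        by_cases h : e z ≤ η
        · exact .inl (hCV ⟨hz, h⟩)
        · exact .inr (not_le.1 h))
    filter_upwards [hU.mem_nhds (hxU rfl), husc] with x hx hsub _ hxσ z hz
    rcases subset_of_mem_nhdsSet hsub hz with h | h
    · have hnot : (x, z.1) ∉ gr := hUV (mk_mem_prod hx h)
      exact (hnot (subset_closure (show _ ∧ _ from ⟨hxσ, hGF x z hz⟩))).elim
    · exact le_of_lt h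
  have hface : ∀ᶠ x in 𝓝 x₀, ∀ σ : Fin 2 → SignType,
      (∀ i, D.localNormal x₀ i = 0 ∨
        SignType.sign (inner ℝ (D.localNormal x₀ i) (x - x₀)) = σ i) → x ∈ D.localFace x₀ σ := by
    have ht : Tendsto (fun x : Euc d => x - x₀) (𝓝 x₀) (𝓝 0) := by
      have : Continuous fun x : Euc d => x - x₀ := by fun_prop
      exact this.tendsto' _ _ (sub_self _)
    filter_upwards [ht.eventually (D.eventually_mem_localFace x₀)] with x hx σ hσ
    simpa using hx σ hσ
  filter_upwards [eventually_all.2 key, hface] with x hx1 hx2 hτ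
  exact hx1 (fun i => SignType.sign (inner ℝ (D.localNormal x₀ i) (x - x₀))) hτ
    (hx2 _ fun i => .inr rfl)

end LimitDynamics

/-! ### Supersolutions and test functions -/

section Supersolution

variable {d N : ℕ} {D : MultiDomain d} {A : Set (Euc N)} {f : Euc d → Euc N → Euc d}
  {ℓ : Euc d → Euc N → ℝ}

theorem deriv_time_eq {φ : ℝ × Euc d → ℝ} {t : ℝ} {x : Euc d}
    (h : DifferentiableAt ℝ φ (t, x)) :
    deriv (fun s => φ (s, x)) t = fderiv ℝ φ (t, x) (1, 0) := by
  have h1 : HasFDerivAt (fun s : ℝ => (s, x)) (ContinuousLinearMap.inl ℝ ℝ (Euc d)) t :=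
    hasFDerivAt_prodMk_left t x
  have h2 : HasFDerivAt (fun s => φ (s, x)) _ t := h.hasFDerivAt.comp t h1
  simpa using h2.hasDerivAt.deriv

theorem inner_gradient_eq {φ : ℝ × Euc d → ℝ} {t : ℝ} {x : Euc d}
    (h : DifferentiableAt ℝ φ (t, x)) (v : Euc d) :
    inner ℝ (gradient (fun y => φ (t, y)) x) v = fderiv ℝ φ (t, x) (0, v) := by
  have h1 : HasFDerivAt (fun y : Euc d => (t, y)) (ContinuousLinearMap.inr ℝ ℝ (Euc d)) x :=
    hasFDerivAt_prodMk_right t x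
  have h2 : HasFDerivAt (fun y : Euc d => φ (t, y)) _ x := h.hasFDerivAt.comp x h1
  rw [gradient, InnerProductSpace.toDual_symm_apply, h2.fderiv]
  simp

theorem map_one_eq_add (L : ℝ × Euc d →L[ℝ] ℝ) (v : Euc d) : L (1, v) = L (1, 0) + L (0, v) := by
  rw [← map_add]; simp

theorem differentiableAt_of_contDiffOn {T : ℝ} {φ : ℝ × Euc d → ℝ}
    (hφ : ContDiffOn ℝ 1 φ (Ioo 0 T ×ˢ univ)) {t : ℝ} (ht : t ∈ Ioo 0 T) (x : Euc d) :
    DifferentiableAt ℝ φ (t, x) :=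
  (hφ.contDiffAt ((isOpen_Ioo.prod isOpen_univ).mem_nhds ⟨ht, mem_univ x⟩)).differentiableAt
    one_ne_zero

/-- If the inequality of a supersolution fails at a point, then it fails uniformly for all the
essential controls. -/
theorem exists_pos_of_not_le {x p : Euc d} {c : ℝ}
    (h : ¬ (0 : EReal) ≤ ((-c : ℝ) : EReal) + essHamiltonian D A f ℓ x p) :
    ∃ η > 0, ∀ a ∈ essControls D A f x, η ≤ c + inner ℝ p (f x a) + ℓ x a := by
  have hlt : essHamiltonian D A f ℓ x p < (c : EReal) := by
    by_contra! hle
    refine h ?_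
    calc (0 : EReal) = ((-c : ℝ) : EReal) + ((c : ℝ) : EReal) := by
          rw [← EReal.coe_add]; simp
      _ ≤ _ := by gcongr
  -- A real number in between gives a finite margin even when the Hamiltonian is `-∞`.
  obtain ⟨r, hr1, hr2⟩ := EReal.lt_iff_exists_real_btwn.1 hlt
  refine ⟨c - r, sub_pos.2 (EReal.coe_lt_coe_iff.1 hr2), fun a ha => ?_⟩
  have : ((-inner ℝ p (f x a) - ℓ x a : ℝ) : EReal) ≤ essHamiltonian D A f ℓ x p :=
    le_iSup₂ (f := fun a _ => ((-inner ℝ p (f x a) - ℓ x a : ℝ) : EReal)) a ha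
  have := EReal.coe_lt_coe_iff.1 (this.trans_lt hr1)
  linarith

/-- The inequality of a supersolution cannot fail uniformly for all the controls. -/
theorem IsSupersolution.not_forall_le {T : ℝ} {u : ℝ × Euc d → ℝ}
    (hu : IsSupersolution D A f ℓ T u) {t : ℝ} (ht : t ∈ Ioo 0 T) {x : Euc d}
    {φ : ℝ × Euc d → ℝ} (hφ : ContDiffOn ℝ 1 φ (Ioo 0 T ×ˢ univ))
    (hmin : IsLocalMin (fun z => u z - φ z) (t, x)) {η : ℝ} (hη : 0 < η) :
    ¬ ∀ a ∈ A, η ≤ fderiv ℝ φ (t, x) (1, f x a) + ℓ x a := by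
  intro hall
  have hd := differentiableAt_of_contDiffOn hφ ht x
  have h0 := hu.2 t ht x φ hφ hmin
  rw [deriv_time_eq hd] at h0
  -- Only the inclusion of the essential controls in `A` matters here; this frees the approximate
  -- problems from any analysis of their essential dynamics.
  have hle : essHamiltonian D A f ℓ x (gradient (fun y => φ (t, y)) x) ≤
      ((fderiv ℝ φ (t, x) (1, 0) - η : ℝ) : EReal) := by
    refine iSup₂_le fun a ha => EReal.coe_le_coe_iff.2 ?_
    have := hall a ha.1
    rw [map_one_eq_add] at this
    rw [inner_gradient_eq hd]
    linarith
  have h1 : (0 : EReal) ≤ ((-fderiv ℝ φ (t, x) (1, 0) : ℝ) : EReal) +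
      ((fderiv ℝ φ (t, x) (1, 0) - η : ℝ) : EReal) := h0.trans (by gcongr)
  rw [← EReal.coe_add] at h1
  have := EReal.coe_nonneg.1 h1
  linarith

end Supersolution

/-- The test function `φ` modified near `(t₀, x₀)` by a quadratic term and by a rescaled function of
two coordinates. -/
noncomputable def perturbedTest {d : ℕ} (φ : ℝ × Euc d → ℝ) (t₀ : ℝ) (x₀ : Euc d)
    (M : Euc d →L[ℝ] ℝ × ℝ) (ψ : ℝ × ℝ → ℝ) (ε : ℝ) (z : ℝ × Euc d) : ℝ :=
  φ z - ((z.1 - t₀) ^ 2 + ‖z.2 - x₀‖ ^ 2) + ε * ψ (ε⁻¹ • M (z.2 - x₀))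

section PerturbedTest

variable {d : ℕ} {φ : ℝ × Euc d → ℝ} {t₀ : ℝ} {x₀ : Euc d} {M : Euc d →L[ℝ] ℝ × ℝ}
  {ψ : ℝ × ℝ → ℝ} {ε : ℝ}

theorem contDiffOn_perturbedTest {s : Set (ℝ × Euc d)} (hφ : ContDiffOn ℝ 1 φ s)
    (hψ : ContDiff ℝ 1 ψ) : ContDiffOn ℝ 1 (perturbedTest φ t₀ x₀ M ψ ε) s := by
  have h1 : ContDiff ℝ 1 fun z : ℝ × Euc d => (z.1 - t₀) ^ 2 + ‖z.2 - x₀‖ ^ 2 :=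
    ((contDiff_fst.sub contDiff_const).pow 2).add ((contDiff_snd.sub contDiff_const).norm_sq ℝ)
  have h2 : ContDiff ℝ 1 fun z : ℝ × Euc d => ε * ψ (ε⁻¹ • M (z.2 - x₀)) :=
    contDiff_const.mul (hψ.comp ((M.contDiff.comp (contDiff_snd.sub contDiff_const)).const_smul _))
  exact (hφ.sub h1.contDiffOn).add h2.contDiffOn

theorem fderiv_perturbedTest {z : ℝ × Euc d} (hφ : DifferentiableAt ℝ φ z) (hε : ε ≠ 0)
    {g : ℝ × ℝ} (hψ : HasFDerivAt ψ (planeForm g) (ε⁻¹ • M (z.2 - x₀))) (w : ℝ × Euc d) :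
    fderiv ℝ (perturbedTest φ t₀ x₀ M ψ ε) z w = fderiv ℝ φ z w
      - (2 * (z.1 - t₀) * w.1 + 2 * inner ℝ (z.2 - x₀) w.2) + planeForm g (M w.2) := by
  have hsnd : HasFDerivAt (fun z : ℝ × Euc d => z.2 - x₀)
      (ContinuousLinearMap.snd ℝ ℝ (Euc d)) z := hasFDerivAt_snd.sub_const x₀
  have hfst : HasFDerivAt (fun z : ℝ × Euc d => z.1 - t₀)
      (ContinuousLinearMap.fst ℝ ℝ (Euc d)) z := hasFDerivAt_fst.sub_const t₀
  have h1 := hfst.pow 2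
  have h2 := hsnd.norm_sq
  have hM : HasFDerivAt (fun z : ℝ × Euc d => M (z.2 - x₀))
      (M.comp (ContinuousLinearMap.snd ℝ ℝ (Euc d))) z := M.hasFDerivAt.comp z hsnd
  have h3 : HasFDerivAt (fun z : ℝ × Euc d => ε⁻¹ • M (z.2 - x₀))
      (ε⁻¹ • M.comp (ContinuousLinearMap.snd ℝ ℝ (Euc d))) z := hM.fun_const_smul _
  have h4 := (hψ.comp z h3).const_mul ε
  have h5 : HasFDerivAt (perturbedTest φ t₀ x₀ M ψ ε) _ z :=
    (hφ.hasFDerivAt.sub (h1.add h2)).add h4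
  rw [h5.fderiv]
  simp [inner_sub_left]
  field_simp

end PerturbedTest

/-! ### Slopes that work near `x₀` for all controls -/

section LocalSlopes

variable {d N : ℕ} {D : MultiDomain d} {A : Set (Euc N)} {f : Euc d → Euc N → Euc d}
  {ℓ : Euc d → Euc N → ℝ} {cf cl lam : ℝ} {Kf Kl : ℝ → ℝ}

theorem fst_mem_dynamics {x : Euc d} {z : Euc d × ℝ} (hz : z ∈ augmentedDynamics A f ℓ cl lam x) :
    z.1 ∈ dynamics A f x := by
  obtain ⟨a, ha, r, -, -, rfl⟩ := hz
  exact ⟨a, ha, rfl⟩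

theorem mem_augmentedDynamics (hL : HL D A ℓ cl lam Kl) (x : Euc d) {a : Euc N} (ha : a ∈ A) :
    (f x a, -ℓ x a) ∈ augmentedDynamics A f ℓ cl lam x :=
  ⟨a, ha, 0, le_rfl, sub_nonneg.2 (hL.growth x _ ⟨a, ha, rfl⟩).2, by simp⟩

theorem convex_dynamics (hL : HL D A ℓ cl lam Kl)
    (hG : ∀ x, Convex ℝ (augmentedDynamics A f ℓ cl lam x)) (x : Euc d) :
    Convex ℝ (dynamics A f x) := by
  have : dynamics A f x =
      (LinearMap.fst ℝ (Euc d) ℝ) '' augmentedDynamics A f ℓ cl lam x := by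
    refine Subset.antisymm ?_ ?_
    · rintro _ ⟨a, ha, rfl⟩
      exact ⟨_, mem_augmentedDynamics hL x ha, rfl⟩
    · rintro _ ⟨z, hz, rfl⟩
      exact fst_mem_dynamics hz
  rw [this]
  exact (hG x).linear_image _

/-- The coordinates with respect to the normals of the hyperplanes through `x₀`. -/
noncomputable def MultiDomain.localCoord (D : MultiDomain d) (x₀ : Euc d) : Euc d →L[ℝ] ℝ × ℝ :=
  (innerSL ℝ (D.localNormal x₀ 0)).prod (innerSL ℝ (D.localNormal x₀ 1))

/-- If the inequality of a supersolution fails for the essential controls at `x₀`, there is a family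
of slopes in the normal directions for which it fails uniformly near `x₀` for all controls. -/
theorem exists_slopes (hF : HF D A f cf Kf) (hL : HL D A ℓ cl lam Kl)
    (hGcompact : ∀ x, IsCompact (augmentedDynamics A f ℓ cl lam x))
    (hGusc : UpperHemicontinuous (augmentedDynamics A f ℓ cl lam))
    (hGconvex : ∀ x, Convex ℝ (augmentedDynamics A f ℓ cl lam x))
    {x₀ : Euc d} {L : ℝ × Euc d →L[ℝ] ℝ} {η₀ : ℝ} (hη₀ : 0 < η₀)
    (hess : ∀ a ∈ essControls D A f x₀, η₀ ≤ L (1, f x₀ a) + ℓ x₀ a) :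
    ∃ (S : SignType → SignType → Set (ℝ × ℝ)) (s : SignType → SignType → ℝ × ℝ) (B η : ℝ),
      SlopeFamily S s ∧ 0 < η ∧ (∀ σ τ, ∀ g ∈ S σ τ, ‖g‖ ≤ B) ∧
      ∀ᶠ x in 𝓝 x₀, ∀ g ∈ S (SignType.sign (D.localCoord x₀ (x - x₀)).1)
        (SignType.sign (D.localCoord x₀ (x - x₀)).2), ∀ a ∈ A,
        η ≤ L (1, f x a) + ℓ x a + planeForm g (D.localCoord x₀ (f x a)) := by
  set E : Euc d × ℝ →L[ℝ] ℝ := (L.comp (ContinuousLinearMap.inr ℝ ℝ (Euc d))).comp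
    (ContinuousLinearMap.fst ℝ (Euc d) ℝ) - ContinuousLinearMap.snd ℝ (Euc d) ℝ with hE
  set l : Fin 2 → Euc d × ℝ →L[ℝ] ℝ := fun i =>
    (innerSL ℝ (D.localNormal x₀ i)).comp (ContinuousLinearMap.fst ℝ (Euc d) ℝ) with hl
  have hmult : ∀ τ : Fin 2 → SignType, ∃ s : ℝ × ℝ, s.1 ≠ 0 ∧ s.2 ≠ 0 ∧
      (τ 0 ≠ 0 → (τ 0 : ℝ) * s.1 < 0) ∧ (τ 1 ≠ 0 → (τ 1 : ℝ) * s.2 < 0) ∧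
      ∀ z ∈ augmentedDynamics A f ℓ cl lam x₀ ∩
        {z | z.1 ∈ extDynamics A f (D.localFace x₀ τ) x₀},
        0 < L (1, 0) + E z + (s.1 * l 0 z + s.2 * l 1 z) := by
    intro τ
    refine exists_multiplier ((hGcompact x₀).inter_right
      ((isClosed_extDynamics A f _ x₀).preimage continuous_fst))
      ((hGconvex x₀).inter ((convex_extDynamics hF (convex_dynamics hL hGconvex) x₀
        τ).linear_preimage (LinearMap.fst ℝ (Euc d) ℝ))) (L (1, 0)) E (l 0) (l 1) (τ 0) (τ 1) ?_
    -- The sign constraints make the velocity tangent to the face, so `a` is essential; the slack `r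
    -- ≥ 0` only increases `E`.
    rintro _ ⟨⟨a, ha, r, hr, -, rfl⟩, hext⟩ h1 h2
    simp only [hl, ContinuousLinearMap.comp_apply, ContinuousLinearMap.coe_fst',
      innerSL_apply_apply] at h1 h2
    have hmem : a ∈ essControls D A f x₀ := by
      refine ⟨ha, D.localFace x₀ τ, D.localFace_mem_strata x₀ τ, D.mem_closure_localFace x₀ τ,
        hext, MultiDomain.mem_tangentConeOf_localFace ?_⟩
      rw [Fin.forall_fin_two]
      exact ⟨h1, h2⟩
    have := hess a hmem
    rw [map_one_eq_add] at this
    simp [hE]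
    linarith
  choose s hs1 hs2 hs3 hs4 hs5 using hmult
  have hbound : ∃ η > 0, ∀ τ : Fin 2 → SignType, ∀ᶠ x in 𝓝 x₀,
      (∀ i, τ i = 0 ∨ τ i = SignType.sign (inner ℝ (D.localNormal x₀ i) (x - x₀))) →
      ∀ z ∈ augmentedDynamics A f ℓ cl lam x,
        η ≤ L (1, 0) + E z + ((s τ).1 * l 0 z + (s τ).2 * l 1 z) := by
    have : ∀ τ : Fin 2 → SignType, ∀ᶠ η in 𝓝[>] (0 : ℝ), ∀ᶠ x in 𝓝 x₀,
        (∀ i, τ i = 0 ∨ τ i = SignType.sign (inner ℝ (D.localNormal x₀ i) (x - x₀))) →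
        ∀ z ∈ augmentedDynamics A f ℓ cl lam x,
          η ≤ L (1, 0) + E z + ((s τ).1 * l 0 z + (s τ).2 * l 1 z) := by
      intro τ
      obtain ⟨η, hη, hev⟩ := eventually_forall_le_of_pos hF (fun x z hz => fst_mem_dynamics hz)
        (hGcompact x₀) (hGusc x₀)
        (e := fun z => L (1, 0) + E z + ((s τ).1 * l 0 z + (s τ).2 * l 1 z)) (by fun_prop)
        (τ := τ) (fun z h1 h2 => hs5 τ z ⟨h1, h2⟩)
      filter_upwards [Ioo_mem_nhdsGT hη] with η' hη'
      filter_upwards [hev] with x hx h1 z hz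
      exact hη'.2.le.trans (hx h1 z hz)
    obtain ⟨η, hη, hpos⟩ := ((eventually_all.2 this).and self_mem_nhdsWithin).exists
    exact ⟨η, hpos, hη⟩
  obtain ⟨η, hη, hev⟩ := hbound
  obtain ⟨B, hB⟩ := ((finite_range s).isBounded).exists_norm_le
  -- The convex hull costs nothing, as the inequality to be kept is affine in the slope.
  set S : SignType → SignType → Set (ℝ × ℝ) := fun σ₁ σ₂ => convexHull ℝ
    {g | ∃ τ : Fin 2 → SignType, (τ 0 = 0 ∨ τ 0 = σ₁) ∧ (τ 1 = 0 ∨ τ 1 = σ₂) ∧ g = s τ} with hS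
  refine ⟨S, fun σ₁ σ₂ => s ![σ₁, σ₂], B, η, ⟨fun _ _ => convex_convexHull _ _, ?_,
    fun _ _ => hs1 _, fun _ _ => hs2 _, fun σ τ h => by simpa using hs3 ![σ, τ] h,
    fun σ τ h => by simpa using hs4 ![σ, τ] h⟩, hη, ?_, ?_⟩
  · intro σ₁ σ₂ σ₁' σ₂' h1 h2
    exact subset_convexHull _ _ ⟨_, by simpa using h1, by simpa using h2, rfl⟩
  · intro σ₁ σ₂ g hg
    have : S σ₁ σ₂ ⊆ Metric.closedBall 0 B := by
      refine convexHull_min ?_ (convex_closedBall _ _)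
      rintro _ ⟨τ, -, -, rfl⟩
      simpa using hB (s τ) ⟨τ, rfl⟩
    simpa using this hg
  · filter_upwards [eventually_all.2 hev] with x hx g hg a ha
    have : S (SignType.sign (D.localCoord x₀ (x - x₀)).1)
        (SignType.sign (D.localCoord x₀ (x - x₀)).2) ⊆
        {g | η ≤ L (1, f x a) + ℓ x a + planeForm g (D.localCoord x₀ (f x a))} := by
      refine convexHull_min ?_ ?_
      · rintro _ ⟨τ, h1, h2, rfl⟩
        have := hx τ (by
          rw [Fin.forall_fin_two]
          exact ⟨by simpa [MultiDomain.localCoord] using h1,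
            by simpa [MultiDomain.localCoord] using h2⟩) _ (mem_augmentedDynamics hL x ha)
        simp [hE, hl] at this
        show η ≤ _
        rw [map_one_eq_add]
        simp [MultiDomain.localCoord]
        linarith
      · intro g₁ h₁ g₂ h₂ a' b' ha' hb' hab
        simp only [mem_ofPred_eq, planeForm_apply] at h₁ h₂ ⊢
        have e1 := mul_le_mul_of_nonneg_left h₁ ha'
        have e2 := mul_le_mul_of_nonneg_left h₂ hb'
        obtain rfl : b' = 1 - a' := by linarith
        simp
        linarith
    exact this hg

end LocalSlopes

/-! ### Perturbation estimate and conclusion -/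

theorem MultiDomain.norm_localCoord_le {d : ℕ} (D : MultiDomain d) (x₀ w : Euc d) :
    ‖D.localCoord x₀ w‖ ≤ ‖w‖ := by
  have h : ∀ i, |inner ℝ (D.localNormal x₀ i) w| ≤ ‖w‖ := by
    intro i
    refine (abs_real_inner_le_norm _ _).trans ?_
    rcases D.norm_localNormal x₀ i with h | h <;> simp [h]
  simp [MultiDomain.localCoord, h]

theorem abs_planeForm_le (g y : ℝ × ℝ) : |planeForm g y| ≤ 2 * ‖g‖ * ‖y‖ := by
  rw [planeForm_apply]
  refine (abs_add_le _ _).trans ?_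
  rw [abs_mul, abs_mul]
  have h1 := mul_le_mul (norm_fst_le g) (norm_fst_le y) (norm_nonneg _) (norm_nonneg _)
  have h2 := mul_le_mul (norm_snd_le g) (norm_snd_le y) (norm_nonneg _) (norm_nonneg _)
  simp only [Real.norm_eq_abs] at h1 h2
  linarith

/-- On a compact set, the uniform estimates on the data and on the perturbed test function preserve
the uniform failure of the inequality of a supersolution. -/
theorem half_le_of_perturbation {d : ℕ} {L L' : ℝ × Euc d →L[ℝ] ℝ} {M : Euc d →L[ℝ] ℝ × ℝ}
    (hM : ∀ w, ‖M w‖ ≤ ‖w‖) {g : ℝ × ℝ} {B C δ κ η s l l' : ℝ} {v v' y : Euc d} (hC : 0 ≤ C)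
    (hδ : 3 * δ * (1 + C) ≤ η / 4) (hκ : (‖L‖ + 2 * B + 1) * κ ≤ η / 4)
    (hg : ‖g‖ ≤ B) (hL : ‖L' - L‖ ≤ δ) (hs : |s| ≤ δ) (hy : ‖y‖ ≤ δ) (hv' : ‖v'‖ ≤ C)
    (hv : dist v v' ≤ κ) (hl : dist l l' ≤ κ)
    (h : η ≤ L (1, v) + l + planeForm g (M v)) :
    η / 2 ≤ L' (1, v') - (2 * s * 1 + 2 * inner ℝ y v') + planeForm g (M v') + l' := by
  have hδ0 : 0 ≤ δ := (abs_nonneg _).trans hs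
  have hκ0 : 0 ≤ κ := dist_nonneg.trans hv
  have hB : 0 ≤ B := (norm_nonneg _).trans hg
  have e1 : |(L' - L) (1, v')| ≤ δ * (1 + C) := by
    refine ((L' - L).le_opNorm _).trans ?_
    refine mul_le_mul hL ?_ (norm_nonneg _) hδ0
    rw [Prod.norm_def]
    simp only [norm_one]
    exact max_le (by linarith) (by linarith)
  have e2 : |L (0, v - v')| ≤ ‖L‖ * κ := by
    refine (L.le_opNorm _).trans (mul_le_mul_of_nonneg_left ?_ (norm_nonneg _))
    rw [Prod.norm_def]
    simpa [hκ0, dist_eq_norm] using hv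
  have e3 : |planeForm g (M (v - v'))| ≤ 2 * B * κ := by
    refine (abs_planeForm_le _ _).trans ?_
    refine mul_le_mul (by linarith) ((hM _).trans ?_) (norm_nonneg _) (by linarith)
    rwa [← dist_eq_norm]
  have e4 : |inner ℝ y v'| ≤ δ * C :=
    (abs_real_inner_le_norm _ _).trans (mul_le_mul hy hv' (norm_nonneg _) hδ0)
  have e5 : |l - l'| ≤ κ := by rwa [← Real.dist_eq]
  have r1 : (L' - L) (1, v') = L' (1, v') - L (1, v') := rfl
  have r2 : L (0, v - v') = L (1, v) - L (1, v') := by rw [← map_sub]; simp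
  have r3 : planeForm g (M (v - v')) = planeForm g (M v) - planeForm g (M v') := by
    rw [map_sub, map_sub]
  rw [r1] at e1
  rw [r2] at e2
  rw [r3] at e3
  rw [abs_le] at e1 e2 e3 e4 e5 hs
  linarith [e1.1, e2.2, e3.2, e4.2, e5.2, hs.2]

theorem mainTheorem10 {d N : ℕ} (D : MultiDomain d)
    (A : Set (Euc N)) (hA : IsCompact A)
    (f : Euc d → Euc N → Euc d) (ℓ : Euc d → Euc N → ℝ)
    (fn : ℕ → Euc d → Euc N → Euc d) (ℓn : ℕ → Euc d → Euc N → ℝ)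
    (T : ℝ) (hT : 0 < T)
    -- hypotheses on the limit problem
    (cf cl lam : ℝ) (Kf Kl : ℝ → ℝ)
    (hF : HF D A f cf Kf) (hL : HL D A ℓ cl lam Kl)
    (hGcompact : ∀ x, IsCompact (augmentedDynamics A f ℓ cl lam x))
    (hGusc : UpperHemicontinuous (augmentedDynamics A f ℓ cl lam))
    (hGconvex : ∀ x, Convex ℝ (augmentedDynamics A f ℓ cl lam x))
    (hcontrollable : ∃ r₁ > 0, ∀ x ∈ D.Γ, Metric.ball 0 r₁ ⊆ dynamics A f x)
    -- the perturbed problems satisfy the standing hypotheses with constants uniform in `n`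
    (cf' cl' lam' : ℝ) (Kf' Kl' : ℝ → ℝ)
    (hFn : ∀ n, HF D A (fn n) cf' Kf') (hLn : ∀ n, HL D A (ℓn n) cl' lam' Kl')
    -- locally uniform convergence of the data
    (hfconv : TendstoLocallyUniformlyOn (fun n z => fn n z.1 z.2)
      (fun z : Euc d × Euc N => f z.1 z.2) atTop (univ ×ˢ A))
    (hℓconv : TendstoLocallyUniformlyOn (fun n z => ℓn n z.1 z.2)
      (fun z : Euc d × Euc N => ℓ z.1 z.2) atTop (univ ×ˢ A))
    -- the supersolutions of the perturbed equations and their limit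
    (un : ℕ → ℝ × Euc d → ℝ) (u : ℝ × Euc d → ℝ)
    (hun : ∀ n, IsSupersolution D A (fn n) (ℓn n) T (un n))
    (hu : LowerSemicontinuousOn u (Icc 0 T ×ˢ univ))
    (huconv : TendstoLocallyUniformlyOn un u atTop (Icc 0 T ×ˢ univ)) :
    IsSupersolution D A f ℓ T u := by
  refine ⟨hu.mono (prod_mono_left Ioc_subset_Icc_self), ?_⟩
  intro t₀ ht₀ x₀ φ hφ hmin
  by_contra hcon
  have hopen : IsOpen (Ioo 0 T ×ˢ (univ : Set (Euc d))) := isOpen_Ioo.prod isOpen_univ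
  have hd₀ := differentiableAt_of_contDiffOn hφ ht₀ x₀
  set L := fderiv ℝ φ (t₀, x₀) with hLdef
  obtain ⟨η₀, hη₀, hess⟩ := exists_pos_of_not_le hcon
  rw [deriv_time_eq hd₀] at hess
  replace hess : ∀ a ∈ essControls D A f x₀, η₀ ≤ L (1, f x₀ a) + ℓ x₀ a := by
    intro a ha
    have := hess a ha
    rwa [inner_gradient_eq hd₀, ← map_one_eq_add] at this
  obtain ⟨S, s, B, η, hS, hη, hB, hslope⟩ :=
    exists_slopes hF hL hGcompact hGusc hGconvex hη₀ hess
  obtain ⟨ψ, Cψ, hψC, hψ0, hψle, hψadm⟩ := hS.hasAdmissible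
  set M := D.localCoord x₀ with hMdef
  have hB0 : 0 ≤ B := (norm_nonneg _).trans
    (hB 0 0 _ (hS.mem 0 0 0 0 (.inl rfl) (.inl rfl)))
  -- Bound of all `f^n` on the unit ball around `x₀`. With it, `δ` limits the cost of moving `Dφ`
  -- and of the quadratic term to `η / 4`, and `κ` does the same for the convergence of the data.
  set C := cf' * (2 + ‖x₀‖) with hCdef
  have hC0 : 0 ≤ C := mul_nonneg (hFn 0).const_pos.le (by positivity)
  set δ := η / (12 * (1 + C)) with hδdef
  have hδ : 0 < δ := by positivity
  have hδeq : 3 * δ * (1 + C) ≤ η / 4 := by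
    rw [hδdef]; apply le_of_eq; field_simp; norm_num
  set κ := η / (4 * (‖L‖ + 2 * B + 1)) with hκdef
  have hκ : 0 < κ := by positivity
  have hκeq : (‖L‖ + 2 * B + 1) * κ ≤ η / 4 := by
    rw [hκdef]; apply le_of_eq; field_simp
  have hev : ∀ᶠ z in 𝓝 (t₀, x₀), z.1 ∈ Ioo 0 T ∧ ‖fderiv ℝ φ z - L‖ ≤ δ ∧
      u (t₀, x₀) - φ (t₀, x₀) ≤ u z - φ z ∧
      ∀ g ∈ S (SignType.sign (M (z.2 - x₀)).1) (SignType.sign (M (z.2 - x₀)).2), ∀ a ∈ A,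
        η ≤ L (1, f z.2 a) + ℓ z.2 a + planeForm g (M (f z.2 a)) := by
    have h1 : ∀ᶠ z in 𝓝 (t₀, x₀), z.1 ∈ Ioo 0 T :=
      continuous_fst.continuousAt.eventually (isOpen_Ioo.mem_nhds ht₀)
    have h2 : ∀ᶠ z in 𝓝 (t₀, x₀), ‖fderiv ℝ φ z - L‖ < δ := by
      have hc : ContinuousAt (fderiv ℝ φ) (t₀, x₀) :=
        (hφ.continuousOn_fderiv_of_isOpen hopen le_rfl).continuousAt
          (hopen.mem_nhds ⟨ht₀, mem_univ _⟩)
      have := hc.eventually (Metric.ball_mem_nhds _ hδ)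
      filter_upwards [this] with z hz
      rwa [← dist_eq_norm]
    have h3 := continuous_snd.continuousAt (x := (t₀, x₀)) |>.eventually hslope
    filter_upwards [h1, h2, hmin, h3] with z k1 k2 k3 k4
    exact ⟨k1, k2.le, k3, k4⟩
  obtain ⟨r, hr, hball⟩ := Metric.eventually_nhds_iff_ball.1 hev
  set ρ := min (r / 2) (min δ 1) with hρdef
  have hρ : 0 < ρ := lt_min (half_pos hr) (lt_min hδ one_pos)
  have hρδ : ρ ≤ δ := (min_le_right _ _).trans (min_le_left _ _)
  have hρ1 : ρ ≤ 1 := (min_le_right _ _).trans (min_le_right _ _)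
  set Q := Metric.closedBall (t₀, x₀) ρ with hQdef
  have hQball : ∀ z ∈ Q, z ∈ Metric.ball (t₀, x₀) r := fun z hz => by
    have h1 : dist z (t₀, x₀) ≤ ρ := hz
    have h2 : ρ ≤ r / 2 := min_le_left _ _
    exact Metric.mem_ball.2 (by linarith)
  have hQsub : Q ⊆ Ioo 0 T ×ˢ univ := fun z hz => ⟨(hball z (hQball z hz)).1, mem_univ _⟩
  have hQcomp : IsCompact Q := isCompact_closedBall _ _
  have hz₀Q : (t₀, x₀) ∈ Q := Metric.mem_closedBall_self hρ.le
  -- The gain `ε ψ` never exceeds `ρ ^ 2`, so the quadratic penalty keeps minimizers off the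
  -- boundary of `Q`.
  set ε := ρ ^ 2 / (|Cψ| + 1) with hεdef
  have hε : 0 < ε := by positivity
  have hεC : ε * Cψ ≤ ρ ^ 2 := by
    have : ε * (|Cψ| + 1) = ρ ^ 2 := div_mul_cancel₀ _ (by positivity)
    rw [← this]
    exact mul_le_mul_of_nonneg_left (by linarith [le_abs_self Cψ]) hε.le
  set Ψ := perturbedTest φ t₀ x₀ M ψ ε with hΨdef
  have hΨ : ContDiffOn ℝ 1 Ψ (Ioo 0 T ×ˢ univ) := contDiffOn_perturbedTest hφ hψC
  have hfn : ∀ᶠ n in atTop, ∀ z ∈ Metric.closedBall x₀ 1 ×ˢ A,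
      dist (f z.1 z.2) (fn n z.1 z.2) < κ :=
    Metric.tendstoUniformlyOn_iff.1 ((tendstoLocallyUniformlyOn_iff_tendstoUniformlyOn_of_compact
      ((isCompact_closedBall x₀ 1).prod hA)).1
      (hfconv.mono (prod_mono_left (subset_univ _)))) κ hκ
  have hℓn : ∀ᶠ n in atTop, ∀ z ∈ Metric.closedBall x₀ 1 ×ˢ A,
      dist (ℓ z.1 z.2) (ℓn n z.1 z.2) < κ :=
    Metric.tendstoUniformlyOn_iff.1 ((tendstoLocallyUniformlyOn_iff_tendstoUniformlyOn_of_compact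
      ((isCompact_closedBall x₀ 1).prod hA)).1
      (hℓconv.mono (prod_mono_left (subset_univ _)))) κ hκ
  have hun' : ∀ᶠ n in atTop, ∀ z ∈ Q, dist (u z) (un n z) < ε / 4 :=
    Metric.tendstoUniformlyOn_iff.1 ((tendstoLocallyUniformlyOn_iff_tendstoUniformlyOn_of_compact
      hQcomp).1 (huconv.mono (hQsub.trans (prod_mono_left Ioo_subset_Icc_self)))) (ε / 4)
      (by positivity)
  obtain ⟨n, hfn, hℓn, hun'⟩ := (hfn.and (hℓn.and hun')).exists
  have hlsc : LowerSemicontinuousOn (fun z => un n z - Ψ z) Q := by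
    have h1 : LowerSemicontinuousOn (un n) Q :=
      (hun n).1.mono (hQsub.trans (prod_mono_left Ioo_subset_Ioc_self))
    have h2 : LowerSemicontinuousOn (fun z => -Ψ z) Q :=
      (hΨ.continuousOn.mono hQsub).neg.lowerSemicontinuousOn
    simpa [sub_eq_add_neg] using h1.add h2
  obtain ⟨⟨t, x⟩, hzQ, hzmin⟩ := hlsc.exists_isMinOn ⟨_, hz₀Q⟩ hQcomp
  obtain ⟨htT, hfd, hle, hgood⟩ := hball _ (hQball _ hzQ)
  simp only at htT hle hgood
  have hdist : max |t - t₀| ‖x - x₀‖ ≤ ρ := by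
    have : dist (t, x) (t₀, x₀) ≤ ρ := hzQ
    rwa [Prod.dist_eq, Real.dist_eq, dist_eq_norm] at this
  have hval : un n (t, x) - Ψ (t, x) ≤ un n (t₀, x₀) - Ψ (t₀, x₀) := hzmin hz₀Q
  have hu1 := hun' _ hzQ
  have hu0 := hun' _ hz₀Q
  rw [Real.dist_eq, abs_lt] at hu1 hu0
  set Z := ψ (ε⁻¹ • M (x - x₀)) with hZ
  have hΨ1 : Ψ (t, x) = φ (t, x) - ((t - t₀) ^ 2 + ‖x - x₀‖ ^ 2) + ε * Z := rfl
  have hΨ0 : Ψ (t₀, x₀) = φ (t₀, x₀) + ε * ψ 0 := by simp [hΨdef, perturbedTest]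
  have hεψ : ε ≤ ε * ψ 0 := le_mul_of_one_le_right hε.le hψ0
  rw [hΨ1, hΨ0] at hval
  -- Since `ψ 0 ≥ 1`, the centre gains at least `ε`, and the two errors `ε / 4` from `u_n` leave `ε
  -- / 2`. The minimizer therefore has `ψ > 0`, which is where the gradient of `ψ` is admissible.
  have hkey : (t - t₀) ^ 2 + ‖x - x₀‖ ^ 2 + ε / 2 < ε * Z := by linarith
  have hsq1 := sq_nonneg (t - t₀)
  have hsq2 := sq_nonneg ‖x - x₀‖
  have hZpos : 0 < Z := (mul_pos_iff_of_pos_left hε).1 (by linarith)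
  have hint : dist (t, x) (t₀, x₀) < ρ := by
    rw [Prod.dist_eq, Real.dist_eq, dist_eq_norm]
    have hZC : ε * Z ≤ ε * Cψ := mul_le_mul_of_nonneg_left (hψle _) hε.le
    refine max_lt (abs_lt_of_sq_lt_sq ?_ hρ.le) (lt_of_pow_lt_pow_left₀ 2 hρ.le ?_)
    · linarith
    · linarith
  have hlocmin : IsLocalMin (fun z => un n z - Ψ z) (t, x) :=
    hzmin.isLocalMin (Metric.closedBall_mem_nhds_of_mem hint)
  obtain ⟨g, hg, hgd⟩ := hψadm _ hZpos
  have hεinv : 0 < ε⁻¹ := inv_pos.2 hε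
  -- Dilation by `ε⁻¹ > 0` preserves the signs of the coordinates.
  have hg' : g ∈ S (SignType.sign (M (x - x₀)).1) (SignType.sign (M (x - x₀)).2) := by
    simpa [sign_mul, sign_pos hεinv] using hg
  refine (hun n).not_forall_le htT hΨ hlocmin (half_pos hη) fun a ha => ?_
  rw [fderiv_perturbedTest (differentiableAt_of_contDiffOn hφ htT x) hε.ne' hgd]
  have hx1 : ‖x - x₀‖ ≤ 1 := ((le_max_right _ _).trans hdist).trans hρ1
  have hxA : ((x, a) : Euc d × Euc N) ∈ Metric.closedBall x₀ 1 ×ˢ A :=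
    ⟨by simpa [dist_eq_norm] using hx1, ha⟩
  have hgrowth : ‖fn n x a‖ ≤ C := by
    refine ((hFn n).growth x _ ⟨a, ha, rfl⟩).trans ?_
    refine mul_le_mul_of_nonneg_left ?_ (hFn n).const_pos.le
    have := norm_le_norm_add_norm_sub' x x₀
    linarith
  exact half_le_of_perturbation (D.norm_localCoord_le x₀) hC0 hδeq hκeq (hB _ _ g hg') hfd
    (((le_max_left _ _).trans hdist).trans hρδ) (((le_max_right _ _).trans hdist).trans hρδ)
    hgrowth (hfn _ hxA).le (hℓn _ hxA).le (hgood g hg' a ha)
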